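/- Let $D\subset\mathbb R^d$ be a bounded open set and $V=H^1_0(D)$ with $\|v\|_V=\|\nabla v\|_{L^2(D)}$ and dual $V^*$ (with the dual norm). Let $s\in\mathbb N$, let $a_1,\dots,a_s\in L^\infty(D)$, and for $\boldsymbol z\in\mathbb R^s$ put $a(\boldsymbol x,\boldsymbol z)=\exp(\sum_{j=1}^s z_ja_j(\boldsymbol x))$; let $a_{\min}(\boldsymbol z)>0$ be such that $a_{\min}(\boldsymbol z)\le a(\boldsymbol x,\boldsymbol z)$ for almost all $\boldsymbol x\in D$. Let $\bar\ell,\ell_0,\dots,\ell_s\in V^*$, where $\ell_0$ is given by a function in $L^\infty(D)$ that is bounded below by a positive constant. Let $\mathcal G\in V^*$, $\mathcal G\neq0$, be a positive functional ($v\ge0$ a.e. implies $\mathcal G(v)\ge0$). For $(w_0,\dots,w_s)\in\mathbb R^{s+1}$ and $\boldsymbol z\in\mathbb R^s$ let $u=u(\cdot,(w_0,\dots,w_s,\boldsymbol z))\in V$ be the solution of $$\int_D a(\boldsymbol x,\boldsymbol z)\,\nabla u\cdot\nabla v\,d\boldsymbol x=\Big(\bar\ell+\sum_{i=0}^s w_i\ell_i\Big)(v)\qquad\text{for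 all }v\in V,$$ and let $u_0(\cdot,\boldsymbol z)\in V$ be the solution of the same equation with right-hand side $\ell_0(v)$. Put $\varphi(y_0,\boldsymbol y)=\mathcal G(u(\cdot,(y_0,\boldsymbol y)))$ for $y_0\in\mathbb R$ and $\boldsymbol y=(\boldsymbol w,\boldsymbol z)=(w_1,\dots,w_s,z_1,\dots,z_s)\in\mathbb R^{2s}$, let $\varphi_0(\boldsymbol z)=\mathcal G(u_0(\cdot,\boldsymbol z))$ (which is positive), let $\xi(t,\boldsymbol y)$ be the real number with $\varphi(\xi(t,\boldsymbol y),\boldsymbol y)=t$, let $\rho(x)=\frac1{\sqrt{2\pi}}e^{-x^2/2}$, and let $b_j=\|a_j\|_{L^\infty(D)}$, $\bar c=\|\bar\ell\|_{V^*}$, $c_i=\|\ell_i\|_{V^*}$. Write $\partial^0$ for the derivative with respect to $y_0$ and $\boldsymbol e_0$ for the multi-index $(1,0,\dots,0)$. Let $q\in\mathbb N_0$ and $\boldsymbol\eta\in\mathbb N_0^{2s}$, and let $r,\beta\in\mathbb N_0$ and $\boldsymbol\alpha_1,\dots,\boldsymbol\alpha_r\in\mathbb N_0^{2s+1}\setminus\{\boldsymbol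 e_0,\boldsymbol 0\}$, with entries $\alpha_{\ell,0},\dots,\alpha_{\ell,2s}$, satisfy $$r\le 2|\boldsymbol\eta|+q-1,\quad \alpha_{\ell,0}\le|\boldsymbol\eta|+q,\quad \beta\le|\boldsymbol\eta|+q-1,\quad \beta\boldsymbol e_0+\sum_{\ell=1}^r\boldsymbol\alpha_\ell=(r+q-1,\boldsymbol\eta).$$ For $t\in\mathbb R$ and $\boldsymbol y=(\boldsymbol w,\boldsymbol z)\in\mathbb R^{2s}$ let $$h_{q,\boldsymbol\eta}(t,\boldsymbol y)=\frac{(-1)^r\rho^{(\beta)}(\xi(t,\boldsymbol y))\prod_{\ell=1}^r\partial^{\boldsymbol\alpha_\ell}\varphi(\xi(t,\boldsymbol y),\boldsymbol y)}{[\partial^0\varphi(\xi(t,\boldsymbol y),\boldsymbol y)]^{r+q}}.$$ Then $$\begin{aligned}|h_{q,\boldsymbol\eta}(t,\boldsymbol y)|\le{}&\frac1{\sqrt{2\pi}}\frac{|\boldsymbol\eta|!\sqrt{(|\boldsymbol\eta|+q-1)!}}{(\ln2)^{|\boldsymbol\eta|}}\Big(\prod_{j=1}^sb_j^{\eta_{j+s}}\Big)\Big(\prod_{i=1}^sc_i^{\eta_i}\Big)\frac1{\varphi_0(\boldsymbol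 z)^{4|\boldsymbol\eta|+3q-2}}\\&\cdot\bigg(\frac{c_0\|\mathcal G\|_{V^*}}{a_{\min}(\boldsymbol z)}\bigg[|t|+\frac{2\|\mathcal G\|_{V^*}}{a_{\min}(\boldsymbol z)}\Big(\bar c+c_0+1+\sum_{i=1}^sc_i|w_i|\Big)\bigg]\bigg)^{2|\boldsymbol\eta|+q-1}.\end{aligned}$$ -/

import Mathlib

open MeasureTheory ProbabilityTheory
open scoped ENNReal ContDiff

noncomputable section

/-! Spatial function spaces -/

/-- Lebesgue measure on the physical domain `D ⊆ ℝ^d`. -/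
abbrev domMeasure {d : ℕ} (D : Set (EuclideanSpace ℝ (Fin d))) :
    Measure (EuclideanSpace ℝ (Fin d)) :=
  (volume : Measure (EuclideanSpace ℝ (Fin d))).restrict D

/-- The graph `{(f, ∇f) : f ∈ C_c^∞(D)}` inside `L²(D) × L²(D; ℝ^d)`. -/
def testGraph {d : ℕ} (D : Set (EuclideanSpace ℝ (Fin d))) :
    Submodule ℝ (Lp ℝ 2 (domMeasure D) × Lp (EuclideanSpace ℝ (Fin d)) 2 (domMeasure D)) where
  carrier := {p | ∃ f : EuclideanSpace ℝ (Fin d) → ℝ,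
    ContDiff ℝ ∞ f ∧ HasCompactSupport f ∧ tsupport f ⊆ D ∧
      p.1 =ᵐ[domMeasure D] f ∧ p.2 =ᵐ[domMeasure D] gradient f}
  zero_mem' := by
    refine ⟨fun _ => 0, contDiff_const, HasCompactSupport.zero, ?_, ?_, ?_⟩
    · simp [tsupport, Function.support]
    · exact Lp.coeFn_zero _ _ _
    · refine (Lp.coeFn_zero _ _ _).trans (Filter.Eventually.of_forall fun x => ?_)
      simp [gradient]
  add_mem' := by
    rintro p p' ⟨f, hf, hfc, hfs, h1, h2⟩ ⟨g, hg, hgc, hgs, h3, h4⟩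
    refine ⟨f + g, hf.add hg, hfc.add hgc,
      (tsupport_add f g).trans (Set.union_subset hfs hgs), ?_, ?_⟩
    · exact (Lp.coeFn_add _ _).trans (h1.add h3)
    · refine (Lp.coeFn_add _ _).trans ((h2.add h4).trans (Filter.Eventually.of_forall fun x => ?_))
      have hf' : DifferentiableAt ℝ f x := (hf.differentiable (by simp)) x
      have hg' : DifferentiableAt ℝ g x := (hg.differentiable (by simp)) x
      simp [gradient, fderiv_add hf' hg']
  smul_mem' := by
    rintro c p ⟨f, hf, hfc, hfs, h1, h2⟩
    refine ⟨c • f, hf.const_smul c, hfc.smul_left (f := fun _ => c),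
      (tsupport_smul_subset_right (fun _ => c) f).trans hfs, ?_, ?_⟩
    · exact (Lp.coeFn_smul c _).trans (h1.const_smul c)
    · refine (Lp.coeFn_smul c _).trans
        ((h2.const_smul c).trans (Filter.Eventually.of_forall fun x => ?_))
      have hf' : DifferentiableAt ℝ f x := (hf.differentiable (by simp)) x
      simp [gradient, fderiv_const_smul hf' c]

/-- `H¹₀(D)`: the closure of the test functions in the `H¹` topology; an element is the pair
`(v, ∇v)` of a function and its weak gradient. -/
def H10 {d : ℕ} (D : Set (EuclideanSpace ℝ (Fin d))) : Type :=
  (testGraph D).topologicalClosure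

namespace H10

variable {d : ℕ} {D : Set (EuclideanSpace ℝ (Fin d))}

instance : AddCommGroup (H10 D) := inferInstanceAs (AddCommGroup (testGraph D).topologicalClosure)

instance : Module ℝ (H10 D) := inferInstanceAs (Module ℝ (testGraph D).topologicalClosure)

/-- The function `v ∈ L²(D)` underlying an element of `H¹₀(D)`. -/
def val : H10 D →ₗ[ℝ] Lp ℝ 2 (domMeasure D) :=
  (LinearMap.fst ℝ _ _).comp (testGraph D).topologicalClosure.subtype

/-- The weak gradient `∇v ∈ L²(D; ℝ^d)` of an element of `H¹₀(D)`. -/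
def grad : H10 D →ₗ[ℝ] Lp (EuclideanSpace ℝ (Fin d)) 2 (domMeasure D) :=
  (LinearMap.snd ℝ _ _).comp (testGraph D).topologicalClosure.subtype

/-- `V = H¹₀(D)` carries the norm `‖v‖_V = ‖∇v‖_{L²(D)}`. (That it is definite for bounded `D` is
Poincaré's inequality, which is not needed to define `V` and its dual.) -/
instance : SeminormedAddCommGroup (H10 D) :=
  SeminormedAddCommGroup.induced (H10 D) (Lp (EuclideanSpace ℝ (Fin d)) 2 (domMeasure D)) grad

instance : NormedSpace ℝ (H10 D) :=
  NormedSpace.induced ℝ (H10 D) (Lp (EuclideanSpace ℝ (Fin d)) 2 (domMeasure D)) grad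

end H10

/-- The dual `V* = H⁻¹(D)`; its norm is `sup |F v| / ‖∇v‖`. -/
abbrev Hneg1 {d : ℕ} (D : Set (EuclideanSpace ℝ (Fin d))) : Type := H10 D →L[ℝ] ℝ

/-- A functional on `V` is positive if it is nonnegative on (a.e.) nonnegative functions. -/
def IsPositiveFunctional {d : ℕ} {D : Set (EuclideanSpace ℝ (Fin d))} (G : Hneg1 D) : Prop :=
  ∀ v : H10 D, (∀ᵐ x ∂(domMeasure D), 0 ≤ H10.val v x) → 0 ≤ G v

/-! The parametric PDE -/

/-- Indices of `(w₀, …, w_s, z₁, …, z_s)`: `Sum.inl i` is `w_i`, `Sum.inr j` is `z_{j+1}`. -/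
abbrev FullIdx (s : ℕ) : Type := Fin (s + 1) ⊕ Fin s

/-- Indices of `(w₁, …, w_s, z₁, …, z_s)`: `Sum.inl i` is `w_{i+1}`, `Sum.inr j` is `z_{j+1}`. -/
abbrev RedIdx (s : ℕ) : Type := Fin s ⊕ Fin s

/-- The vector `(w₀, w₁, …, w_s, z₁, …, z_s)`. -/
def fullParam {s : ℕ} (w₀ : ℝ) (w z : Fin s → ℝ) : FullIdx s → ℝ :=
  Sum.elim (Fin.cons w₀ w) z

/-- The lognormal coefficient `a(x, z) = exp (∑ z_j a_j(x))`. -/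
def coeff {d s : ℕ} {D : Set (EuclideanSpace ℝ (Fin d))} (a : Fin s → Lp ℝ ∞ (domMeasure D))
    (z : Fin s → ℝ) (x : EuclideanSpace ℝ (Fin d)) : ℝ :=
  Real.exp (∑ j, z j * a j x)

/-- `u ∈ V` solves `∫_D a(x, z) ∇u · ∇v dx = F(v)` for all `v ∈ V`. -/
def IsWeakSolution {d s : ℕ} {D : Set (EuclideanSpace ℝ (Fin d))}
    (a : Fin s → Lp ℝ ∞ (domMeasure D)) (z : Fin s → ℝ) (F : Hneg1 D) (u : H10 D) : Prop :=
  ∀ v : H10 D,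
    ∫ x, coeff a z x * inner ℝ (H10.grad u x) (H10.grad v x) ∂(domMeasure D) = F v

/-- The source term `ℓ(w) = ℓ̄ + ∑_{i=0}^s w_i ℓ_i ∈ V*`. -/
def source {d s : ℕ} {D : Set (EuclideanSpace ℝ (Fin d))}
    (lbar : Hneg1 D) (l : Fin (s + 1) → Hneg1 D) (w : Fin (s + 1) → ℝ) : Hneg1 D :=
  lbar + ∑ i, w i • l i

/-! The chain-rule terms -/

/-- First-order partial derivative `∂^i f`. -/
def pderivAt {ι : Type} [DecidableEq ι] (i : ι) (f : (ι → ℝ) → ℝ) : (ι → ℝ) → ℝ :=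
  fun y => lineDeriv ℝ f y (Pi.single i 1)

/-- Mixed partial derivative `∂^α f = ∏_i ∂^{α_i}/∂y_i^{α_i} f`. -/
def mixedDeriv {s : ℕ} (α : FullIdx s → ℕ) (f : (FullIdx s → ℝ) → ℝ) : (FullIdx s → ℝ) → ℝ :=
  (List.finRange (s + 1)).foldr (fun i g => (pderivAt (Sum.inl i))^[α (Sum.inl i)] g)
    ((List.finRange s).foldr (fun j g => (pderivAt (Sum.inr j))^[α (Sum.inr j)] g) f)

/-- The point `ξ(t, (w, z))` with `φ(ξ, w, z) = t` (unique for `φ` strictly increasing in its first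
variable). -/
def xiPoint {s : ℕ} (φ : (FullIdx s → ℝ) → ℝ) (t : ℝ) (w z : Fin s → ℝ) : ℝ :=
  Classical.epsilon fun y₀ : ℝ => φ (fullParam y₀ w z) = t

/-- The order `|η| = ∑ η_i` of a multi-index. -/
def order {s : ℕ} (η : RedIdx s → ℕ) : ℕ := ∑ i, η i

/-- The conditions on the parameters `(r, α, β)`; the (possibly negative) numbers `… - 1` are
computed in `ℤ`. -/
structure IsAdmissible {s : ℕ} (q : ℕ) (η : RedIdx s → ℕ) (r : ℕ) (α : Fin r → FullIdx s → ℕ)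
    (β : ℕ) : Prop where
  ne_zero : ∀ k, α k ≠ 0
  ne_single : ∀ k, α k ≠ Pi.single (Sum.inl 0) 1
  r_le : (r : ℤ) ≤ 2 * (order η : ℤ) + q - 1
  first_le : ∀ k, α k (Sum.inl 0) ≤ order η + q
  β_le : (β : ℤ) ≤ (order η : ℤ) + q - 1
  sum_first : (β : ℤ) + (∑ k, α k (Sum.inl 0) : ℕ) = r + q - 1
  sum_w : ∀ i : Fin s, ∑ k, α k (Sum.inl i.succ) = η (Sum.inl i)
  sum_z : ∀ j : Fin s, ∑ k, α k (Sum.inr j) = η (Sum.inr j)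

/-- The chain-rule term
`(-1)^r ρ^{(β)}(ξ) ∏_k ∂^{α_k} φ(ξ, y) / [∂^0 φ(ξ, y)]^{r+q}` with `ξ = ξ(t, y)`, `y = (w, z)`,
`ρ` the standard normal density. -/
def hTerm {s : ℕ} (φ : (FullIdx s → ℝ) → ℝ) (q r : ℕ) (α : Fin r → FullIdx s → ℕ) (β : ℕ)
    (t : ℝ) (w z : Fin s → ℝ) : ℝ :=
  (-1) ^ r * iteratedDeriv β (gaussianPDFReal 0 1) (xiPoint φ t w z)
      * (∏ k, mixedDeriv (α k) φ (fullParam (xiPoint φ t w z) w z))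
    / pderivAt (Sum.inl 0) φ (fullParam (xiPoint φ t w z) w z) ^ (r + q)

end

/-!
By Poincaré's inequality the gradients of `H¹₀(D)` form a closed subspace `K` of `L²(D; ℝ^d)`, and
everything takes place in this Hilbert space. The equation reads `A(z) p = f(w)` with `p = ∇u`, where
`A(z)` is the compression to `K` of the multiplication by `a(·, z)` and the source `f(w)` is affine
in `w`. Hence `φ(w, z) = ⟨g, A(z)⁻¹ f(w)⟩`, with Riesz representatives `g` of `G` and `f(w)` of the
source. As a function of `w` it is affine; its slope in `w₀` is `φ₀(z) = G(u₀(z))`, so that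
`ξ = (t - φ(0, w, z)) / φ₀`, which is bounded by the data divided by `φ₀`.

* *Positivity of `φ₀`* (`H10.functional_solution_pos`). If `p` solves the equation with source `G`,
  then `φ₀ = ℓ₀(p) = ∫ l₀ p` by symmetry. The weak maximum principle
  `H10.val_nonneg_of_isPositiveFunctional` gives `p ≥ 0`, and `p` does not vanish as `G ≠ 0`.
* *Derivatives in `z`* (`norm_foldr_partialD_solutionOp_le`). Mixed derivatives are taken along
  words of directions. The derivative of `A(z)` along a word `S` is given by the weight
  `∏_{j ∈ S} a_j · a(·, z)`, whose form is bounded by `∏_{j ∈ S} ‖a_j‖` in the energy norm.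
  Differentiating `A A⁻¹ = 1` along a word of length `n` by the Leibniz formula bounds the
  derivative of `A⁻¹` in the energy norm by the ordered Bell numbers, which are at most
  `n! / (ln 2)^n` (`sum_choose_mul_factorial_div_le`).
* *Derivatives in `w`* (`abs_foldr_pderivAt_inl_qoi_le`). One derivative replaces the source by
  some `ℓ_i`, and two of them give zero.
* *The Gaussian factor* (`abs_iteratedDeriv_gaussianPDFReal_le`). The function `f = ρ⁽ⁿ⁾` solves
  `f'' + x f' + (n + 1) f = 0`, whose energy is maximal at `0`; so `|ρ⁽ⁿ⁾| ≤ √(n!) / √(2π)`.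

Each factor `∂^α φ / φ₀` is therefore at most `Q = c₀ γ X / φ₀²`, where `γ = ‖G‖ / a_min` and `X` is
the last bracket of the claim, times its share of the powers of `‖a_j‖` and `‖ℓ_i‖` and of the
factorials (`exists_common_bound`, `abs_mixedDeriv_qoi_le`). Since `Q ≥ 1`, the number `r` of factors
may be replaced by its upper bound `2|η| + q - 1`.
-/

/-! ### Derivatives of the Gaussian density -/

lemma hasDerivAt_gaussianPDFReal (x : ℝ) :
    HasDerivAt (gaussianPDFReal 0 1) (-x * gaussianPDFReal 0 1 x) x := by
  have h : HasDerivAt (fun y : ℝ => (√(2 * Real.pi * 1))⁻¹ * Real.exp (-(y - 0) ^ 2 / (2 * 1)))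
      ((√(2 * Real.pi * 1))⁻¹ * (Real.exp (-(x - 0) ^ 2 / (2 * 1)) *
        (-(2 * (x - 0)) / (2 * 1)))) x := by
    have h1 : HasDerivAt (fun y : ℝ => -(y - 0) ^ 2 / (2 * 1)) (-(2 * (x - 0)) / (2 * 1)) x := by
      have := (((hasDerivAt_id x).sub_const 0).pow 2).neg.div_const (2 * 1)
      simpa using this
    exact (h1.exp).const_mul _
  have e : gaussianPDFReal 0 1 =
      fun y : ℝ => (√(2 * Real.pi * 1))⁻¹ * Real.exp (-(y - 0) ^ 2 / (2 * 1)) := by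
    funext y; simp [gaussianPDFReal]
  rw [e]
  convert h using 1
  ring

lemma contDiff_gaussianPDFReal : ContDiff ℝ ∞ (gaussianPDFReal 0 1) := by
  have e : gaussianPDFReal 0 1 =
      fun y : ℝ => (√(2 * Real.pi * 1))⁻¹ * Real.exp (-(y - 0) ^ 2 / (2 * 1)) := by
    funext y; simp [gaussianPDFReal]
  rw [e]
  fun_prop

lemma hasDerivAt_iteratedDeriv_gaussianPDFReal (n : ℕ) (x : ℝ) :
    HasDerivAt (iteratedDeriv n (gaussianPDFReal 0 1))
      (iteratedDeriv (n + 1) (gaussianPDFReal 0 1) x) x := by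
  rw [iteratedDeriv_succ]
  exact (contDiff_gaussianPDFReal.differentiable_iteratedDeriv n
    (by exact_mod_cast ENat.natCast_lt_top n) x).hasDerivAt

/-- The three-term recurrence of the Hermite functions `ρ⁽ⁿ⁾`. -/
lemma iteratedDeriv_gaussianPDFReal_add_two (n : ℕ) (x : ℝ) :
    iteratedDeriv (n + 2) (gaussianPDFReal 0 1) x =
      -x * iteratedDeriv (n + 1) (gaussianPDFReal 0 1) x
        - (n + 1) * iteratedDeriv n (gaussianPDFReal 0 1) x := by
  have h1 : iteratedDeriv 1 (gaussianPDFReal 0 1) = fun x => -x * gaussianPDFReal 0 1 x := by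
    funext y
    rw [iteratedDeriv_one]
    exact (hasDerivAt_gaussianPDFReal y).deriv
  induction n generalizing x with
  | zero =>
    have h := hasDerivAt_iteratedDeriv_gaussianPDFReal 1 x
    have h' : HasDerivAt (iteratedDeriv 1 (gaussianPDFReal 0 1))
        (-1 * gaussianPDFReal 0 1 x + -x * (-x * gaussianPDFReal 0 1 x)) x := by
      rw [h1]
      exact (hasDerivAt_id x).neg.mul (hasDerivAt_gaussianPDFReal x)
    have := h.unique h'
    simp only [zero_add, this, h1, iteratedDeriv_zero]
    push_cast
    ring
  | succ n ih =>
    have h := hasDerivAt_iteratedDeriv_gaussianPDFReal (n + 2) x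
    have h' : HasDerivAt (iteratedDeriv (n + 2) (gaussianPDFReal 0 1))
        ((-1 * iteratedDeriv (n + 1) (gaussianPDFReal 0 1) x
          + -x * iteratedDeriv (n + 2) (gaussianPDFReal 0 1) x)
          - (n + 1) * iteratedDeriv (n + 1) (gaussianPDFReal 0 1) x) x := by
      rw [show iteratedDeriv (n + 2) (gaussianPDFReal 0 1) = fun x =>
        -x * iteratedDeriv (n + 1) (gaussianPDFReal 0 1) x
        - (n + 1) * iteratedDeriv n (gaussianPDFReal 0 1) x from funext ih]
      have hA := ((hasDerivAt_id x).neg.mul (hasDerivAt_iteratedDeriv_gaussianPDFReal (n + 1) x)).sub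
        ((hasDerivAt_iteratedDeriv_gaussianPDFReal n x).const_mul ((n : ℝ) + 1))
      refine hA.congr_deriv ?_
      simp [ih]
    rw [show n + 1 + 2 = n + 2 + 1 from rfl, h.unique h']
    push_cast
    ring

lemma sq_iteratedDeriv_gaussianPDFReal_zero (n : ℕ) :
    (iteratedDeriv n (gaussianPDFReal 0 1) 0) ^ 2 ≤ n.factorial / (2 * Real.pi)
      ∧ (iteratedDeriv (n + 1) (gaussianPDFReal 0 1) 0) ^ 2 ≤ (n + 1).factorial / (2 * Real.pi)
      ∧ (iteratedDeriv n (gaussianPDFReal 0 1) 0 = 0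
        ∨ iteratedDeriv (n + 1) (gaussianPDFReal 0 1) 0 = 0) := by
  have hpi := Real.pi_pos
  induction n with
  | zero =>
    have h1 : iteratedDeriv 1 (gaussianPDFReal 0 1) 0 = 0 := by
      rw [iteratedDeriv_one, (hasDerivAt_gaussianPDFReal 0).deriv]; simp
    refine ⟨?_, ?_, Or.inr h1⟩
    · simp only [iteratedDeriv_zero, gaussianPDFReal]
      simp [mul_pow, inv_pow, Real.sq_sqrt, hpi.le]
    · rw [zero_add, h1, zero_pow two_ne_zero]; positivity
  | succ n ih =>
    obtain ⟨h0, h1, h2⟩ := ih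
    have e : iteratedDeriv (n + 1 + 1) (gaussianPDFReal 0 1) 0
        = -((n : ℝ) + 1) * iteratedDeriv n (gaussianPDFReal 0 1) 0 := by
      rw [iteratedDeriv_gaussianPDFReal_add_two]; ring
    refine ⟨h1, ?_, ?_⟩
    · rw [e, mul_pow, neg_sq]
      calc ((n : ℝ) + 1) ^ 2 * _ ≤ ((n : ℝ) + 1) ^ 2 * (n.factorial / (2 * Real.pi)) := by gcongr
        _ = (n + 1) * ((n + 1).factorial / (2 * Real.pi)) := by
          rw [Nat.factorial_succ n]; push_cast; ring
        _ ≤ (n + 2) * ((n + 1).factorial / (2 * Real.pi)) := by gcongr; norm_num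
        _ = _ := by rw [Nat.factorial_succ (n + 1)]; push_cast; ring
    · rcases h2 with h | h
      · right; rw [e, h, mul_zero]
      · left; exact h

/-- The energy `f² + f'² / (n + 1)` of the solution `f = ρ⁽ⁿ⁾` of `f'' + x f' + (n + 1) f = 0` has
derivative `-2 x f'² / (n + 1)`, so that it is maximal at `0`. -/
lemma gaussian_energy_le (n : ℕ) (x : ℝ) :
    (iteratedDeriv n (gaussianPDFReal 0 1) x) ^ 2
        + (iteratedDeriv (n + 1) (gaussianPDFReal 0 1) x) ^ 2 / (n + 1)
      ≤ (iteratedDeriv n (gaussianPDFReal 0 1) 0) ^ 2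
        + (iteratedDeriv (n + 1) (gaussianPDFReal 0 1) 0) ^ 2 / (n + 1) := by
  set E : ℝ → ℝ := fun x => (iteratedDeriv n (gaussianPDFReal 0 1) x) ^ 2
        + (iteratedDeriv (n + 1) (gaussianPDFReal 0 1) x) ^ 2 / (n + 1) with hE
  have hd : ∀ x, HasDerivAt E
      (-x * (2 * (iteratedDeriv (n + 1) (gaussianPDFReal 0 1) x) ^ 2 / (n + 1))) x := by
    intro x
    have h := ((hasDerivAt_iteratedDeriv_gaussianPDFReal n x).pow 2).add
      (((hasDerivAt_iteratedDeriv_gaussianPDFReal (n + 1) x).pow 2).div_const ((n : ℝ) + 1))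
    refine h.congr_deriv ?_
    rw [show n + 1 + 1 = n + 2 from rfl, iteratedDeriv_gaussianPDFReal_add_two]
    have : (n : ℝ) + 1 ≠ 0 := by positivity
    field_simp
    ring
  have hdiff : Differentiable ℝ E := fun x => (hd x).differentiableAt
  rcases le_total 0 x with hx | hx
  · refine antitoneOn_of_deriv_nonpos (convex_Ici 0) hdiff.continuous.continuousOn
      hdiff.differentiableOn (fun y hy => ?_) (Set.self_mem_Ici) hx hx
    rw [interior_Ici] at hy
    rw [(hd y).deriv]
    have : 0 ≤ 2 * (iteratedDeriv (n + 1) (gaussianPDFReal 0 1) y) ^ 2 / ((n : ℝ) + 1) := by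
      positivity
    nlinarith [Set.mem_Ioi.1 hy]
  · refine monotoneOn_of_deriv_nonneg (convex_Iic 0) hdiff.continuous.continuousOn
      hdiff.differentiableOn (fun y hy => ?_) hx (Set.self_mem_Iic) hx
    rw [interior_Iic] at hy
    rw [(hd y).deriv]
    have : 0 ≤ 2 * (iteratedDeriv (n + 1) (gaussianPDFReal 0 1) y) ^ 2 / ((n : ℝ) + 1) := by
      positivity
    nlinarith [Set.mem_Iio.1 hy]

/-- A Cramér-type inequality for the derivatives of the standard normal density. -/
theorem abs_iteratedDeriv_gaussianPDFReal_le (n : ℕ) (x : ℝ) :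
    |iteratedDeriv n (gaussianPDFReal 0 1) x| ≤ 1 / √(2 * Real.pi) * √(n.factorial : ℝ) := by
  have hpi := Real.pi_pos
  obtain ⟨h0, h1, h2⟩ := sq_iteratedDeriv_gaussianPDFReal_zero n
  have hE := gaussian_energy_le n x
  have hn : (0 : ℝ) < n + 1 := by positivity
  have h1' : (iteratedDeriv (n + 1) (gaussianPDFReal 0 1) 0) ^ 2 / (n + 1)
      ≤ n.factorial / (2 * Real.pi) := by
    rw [div_le_iff₀ hn]
    refine h1.trans (le_of_eq ?_)
    rw [Nat.factorial_succ]; push_cast; ring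
  have hb : (iteratedDeriv n (gaussianPDFReal 0 1) 0) ^ 2
        + (iteratedDeriv (n + 1) (gaussianPDFReal 0 1) 0) ^ 2 / (n + 1)
        ≤ n.factorial / (2 * Real.pi) := by
    rcases h2 with h | h
    · rw [h]; simpa using h1'
    · rw [h]; simpa using h0
  have hsq : (iteratedDeriv n (gaussianPDFReal 0 1) x) ^ 2 ≤ n.factorial / (2 * Real.pi) := by
    have : 0 ≤ (iteratedDeriv (n + 1) (gaussianPDFReal 0 1) x) ^ 2 / ((n : ℝ) + 1) := by positivity
    linarith
  calc |iteratedDeriv n (gaussianPDFReal 0 1) x| ≤ √(n.factorial / (2 * Real.pi)) :=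
        Real.abs_le_sqrt hsq
    _ = _ := by rw [Real.sqrt_div (by positivity)]; ring

/-! ### Leibniz splittings of words -/

/-- The splittings of a word `L` into two complementary subwords `(S, S')` with `S` nonempty, with
multiplicity: the terms, other than `X · ∂_L Y`, of the Leibniz formula for `∂_L (X Y)`. -/
def properSplits {ι : Type*} : List ι → List (List ι × List ι)
  | [] => []
  | j :: L => (properSplits L ++ [([], L)]).map (fun p : List ι × List ι => (j :: p.1, p.2))
      ++ (properSplits L).map (fun p : List ι × List ι => (p.1, j :: p.2))

lemma length_lt_of_mem_properSplits {ι : Type*} {L : List ι} {p : List ι × List ι}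
    (hp : p ∈ properSplits L) : p.2.length < L.length := by
  induction L generalizing p with
  | nil => simp [properSplits] at hp
  | cons j L ih =>
    simp only [properSplits, List.map_append, List.mem_append, List.mem_map, List.mem_singleton,
      List.map_cons, List.map_nil] at hp
    rcases hp with (⟨x, hx, rfl⟩ | rfl) | ⟨x, hx, rfl⟩
    · simpa using (ih hx).trans (Nat.lt_succ_self _)
    · simp
    · simpa using ih hx

lemma prod_map_mul_of_mem_properSplits {ι : Type*} (b : ι → ℝ) {L : List ι}
    {p : List ι × List ι} (hp : p ∈ properSplits L) :
    (p.1.map b).prod * (p.2.map b).prod = (L.map b).prod := by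
  induction L generalizing p with
  | nil => simp [properSplits] at hp
  | cons j L ih =>
    simp only [properSplits, List.map_append, List.mem_append, List.mem_map, List.mem_singleton,
      List.map_cons, List.map_nil] at hp
    rcases hp with (⟨x, hx, rfl⟩ | rfl) | ⟨x, hx, rfl⟩
    · simp [← ih hx, mul_assoc]
    · simp
    · simp [← ih hx, mul_left_comm]

lemma sum_properSplits {ι : Type*} (f : ℕ → ℝ) (L : List ι) :
    ((properSplits L).map (fun p => f p.2.length)).sum =
      ∑ k ∈ Finset.range L.length, (L.length.choose k : ℝ) * f k := by
  induction L generalizing f with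
  | nil => simp [properSplits]
  | cons j L ih =>
    have e1 := ih f
    have e2 := ih (fun k => f (k + 1))
    have e3 := Finset.sum_choose_succ_mul (R := ℝ) (fun i _ => f i) L.length
    have e4 := Finset.sum_range_succ (fun k => ((L.length + 1).choose k : ℝ) * f k) (L.length + 1)
    have e5 := Finset.sum_range_succ (fun k => (L.length.choose k : ℝ) * f k) L.length
    have e6 := Finset.sum_range_succ (fun k => (L.length.choose k : ℝ) * f (k + 1)) L.length
    simp only [Nat.choose_self, Nat.cast_one, one_mul] at e3 e4 e5 e6
    simp only [properSplits, List.map_append, List.map_map, Function.comp_def, List.sum_append,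
      List.length_cons, List.map_cons, List.map_nil, List.sum_cons, List.sum_nil, e1, e2]
    linarith

/-- The numbers `k! / (ln 2)^k` dominate the ordered Bell numbers. -/
lemma sum_choose_mul_factorial_div_le (n : ℕ) :
    ∑ k ∈ Finset.range n, (n.choose k : ℝ) * (k.factorial / Real.log 2 ^ k)
      ≤ n.factorial / Real.log 2 ^ n := by
  have hl : 0 < Real.log 2 := Real.log_pos (by norm_num)
  have hexp := Real.sum_le_exp_of_nonneg hl.le (n + 1)
  rw [Real.exp_log (by norm_num), Finset.sum_range_succ', pow_zero, Nat.factorial_zero] at hexp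
  have h1 : ∑ i ∈ Finset.range n, Real.log 2 ^ (i + 1) / (i + 1).factorial ≤ 1 := by
    norm_num at hexp ⊢; linarith
  rw [← Finset.sum_range_reflect] at h1
  calc _ = (n.factorial / Real.log 2 ^ n) * ∑ j ∈ Finset.range n,
        Real.log 2 ^ (n - 1 - j + 1) / (n - 1 - j + 1).factorial := by
        rw [Finset.mul_sum]
        refine Finset.sum_congr rfl fun k hk => ?_
        have hk' : k < n := Finset.mem_range.1 hk
        rw [show n - 1 - k + 1 = n - k by omega, Nat.cast_choose ℝ hk'.le,
          show Real.log 2 ^ n = Real.log 2 ^ (n - k) * Real.log 2 ^ k by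
            rw [← pow_add]; congr 1; omega]
        field_simp
    _ ≤ (n.factorial / Real.log 2 ^ n) * 1 := by gcongr
    _ = _ := mul_one _

/-! ### Mixed derivatives along words -/

lemma foldr_iterate_eq_foldr_word {ι β : Type*} (P : ι → β → β) (n : ι → ℕ) (L : List ι) (f : β) :
    L.foldr (fun i g => (P i)^[n i] g) f
      = (L.flatMap fun i => List.replicate (n i) i).foldr P f := by
  induction L with
  | nil => rfl
  | cons i L ih =>
    simp only [List.foldr_cons, List.flatMap_cons, List.foldr_append, ih]
    generalize List.foldr P f (L.flatMap fun i => List.replicate (n i) i) = g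
    induction n i with
    | zero => rfl
    | succ k ihk => rw [Function.iterate_succ_apply', ihk, List.replicate_succ, List.foldr_cons]

/-- The word in which each letter `i` occurs `n i` times. -/
def multiWord {m : ℕ} (n : Fin m → ℕ) : List (Fin m) :=
  (List.finRange m).flatMap fun i => List.replicate (n i) i

lemma length_multiWord {m : ℕ} (n : Fin m → ℕ) : (multiWord n).length = ∑ i, n i := by
  simp [multiWord, List.length_flatMap, Fin.sum_univ_def]

lemma prod_map_multiWord {m : ℕ} (n : Fin m → ℕ) (b : Fin m → ℝ) :
    ((multiWord n).map b).prod = ∏ i, b i ^ n i := by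
  rw [Fin.prod_univ_def, multiWord]
  generalize List.finRange m = L
  induction L with
  | nil => simp
  | cons i L ih => simp [List.flatMap_cons, ih]

lemma mixedDeriv_eq_foldr {s : ℕ} (α : FullIdx s → ℕ) (f : (FullIdx s → ℝ) → ℝ) :
    mixedDeriv α f =
      (multiWord fun i => α (Sum.inl i)).foldr (fun i => pderivAt (Sum.inl i))
        ((multiWord fun j => α (Sum.inr j)).foldr (fun j => pderivAt (Sum.inr j)) f) := by
  rw [mixedDeriv, foldr_iterate_eq_foldr_word (fun i : Fin (s + 1) => pderivAt (Sum.inl i)),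
    foldr_iterate_eq_foldr_word (fun j : Fin s => pderivAt (Sum.inr j))]
  rfl

/-! ### The Sobolev space `H¹₀(D)` -/

lemma norm_sq_Lp_two {F : Type*} [NormedAddCommGroup F] [InnerProductSpace ℝ F]
    {X : Type*} [MeasurableSpace X] {μ : Measure X} (f : Lp F 2 μ) :
    ‖f‖ ^ 2 = ∫ x, ‖f x‖ ^ 2 ∂μ := by
  rw [← real_inner_self_eq_norm_sq, L2.inner_def]
  simp

namespace H10

variable {d : ℕ} {D : Set (EuclideanSpace ℝ (Fin d))}

lemma norm_eq_norm_grad (v : H10 D) : ‖v‖ = ‖grad v‖ := rfl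

lemma ext_of_val_grad {v v' : H10 D} (h1 : val v = val v') (h2 : grad v = grad v') : v = v' :=
  Subtype.ext (Prod.ext h1 h2)

/-- `v ∈ H¹₀(D)` is (the class of) the test function `f ∈ C_c^∞(D)`. -/
structure IsTest (v : H10 D) (f : EuclideanSpace ℝ (Fin d) → ℝ) : Prop where
  contDiff : ContDiff ℝ ∞ f
  hasCompactSupport : HasCompactSupport f
  tsupport_subset : tsupport f ⊆ D
  val_ae : val v =ᵐ[domMeasure D] f
  grad_ae : grad v =ᵐ[domMeasure D] gradient f

lemma continuous_gradient {f : EuclideanSpace ℝ (Fin d) → ℝ} (hf : ContDiff ℝ ∞ f) :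
    Continuous (gradient f) :=
  (InnerProductSpace.toDual ℝ _).symm.continuous.comp (hf.continuous_fderiv (by simp))

lemma hasCompactSupport_gradient {f : EuclideanSpace ℝ (Fin d) → ℝ} (hf : HasCompactSupport f) :
    HasCompactSupport (gradient f) := by
  have h := (hf.fderiv ℝ).comp_left (g := (InnerProductSpace.toDual ℝ _).symm) (map_zero _)
  exact h

lemma exists_isTest {f : EuclideanSpace ℝ (Fin d) → ℝ} (hf : ContDiff ℝ ∞ f)
    (hc : HasCompactSupport f) (hs : tsupport f ⊆ D) : ∃ v : H10 D, IsTest v f := by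
  have h1 : MemLp f 2 (domMeasure D) := hf.continuous.memLp_of_hasCompactSupport hc
  have h2 : MemLp (gradient f) 2 (domMeasure D) :=
    (continuous_gradient hf).memLp_of_hasCompactSupport (hasCompactSupport_gradient hc)
  refine ⟨⟨(h1.toLp f, h2.toLp _), subset_closure ⟨f, hf, hc, hs, h1.coeFn_toLp, h2.coeFn_toLp⟩⟩,
    hf, hc, hs, h1.coeFn_toLp, h2.coeFn_toLp⟩

lemma exists_isTest_near (v : H10 D) {ε : ℝ} (hε : 0 < ε) :
    ∃ (v' : H10 D) (f : EuclideanSpace ℝ (Fin d) → ℝ), IsTest v' f ∧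
      ‖val v - val v'‖ < ε ∧ ‖grad v - grad v'‖ < ε := by
  obtain ⟨p, hp, hd⟩ := Metric.mem_closure_iff.1 v.2 ε hε
  obtain ⟨f, hf, hc, hs, h1, h2⟩ := hp
  rw [Prod.dist_eq, max_lt_iff, dist_eq_norm, dist_eq_norm] at hd
  exact ⟨⟨p, subset_closure ⟨f, hf, hc, hs, h1, h2⟩⟩, f, ⟨hf, hc, hs, h1, h2⟩, hd.1, hd.2⟩

lemma norm_gradient (f : EuclideanSpace ℝ (Fin d) → ℝ) (x : EuclideanSpace ℝ (Fin d)) :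
    ‖gradient f x‖ = ‖fderiv ℝ f x‖ := by
  simp [gradient]

/-- Poincaré's inequality for test functions: integrate the derivative of `x_i f²`. -/
lemma integral_sq_le_of_test (i : Fin d) {R : ℝ} (hR : ∀ x ∈ D, ‖x‖ ≤ R)
    {f : EuclideanSpace ℝ (Fin d) → ℝ} (hf : ContDiff ℝ ∞ f)
    (hc : HasCompactSupport f) (hs : tsupport f ⊆ D) :
    ∫ x, f x ^ 2 ≤ 4 * R ^ 2 * ∫ x, ‖gradient f x‖ ^ 2 := by
  set e : EuclideanSpace ℝ (Fin d) := EuclideanSpace.single i 1 with he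
  have hdf : Differentiable ℝ f := hf.differentiable (by simp)
  have hfc : Continuous f := hf.continuous
  have hf'c : Continuous fun x => fderiv ℝ f x e :=
    (hf.continuous_fderiv (by simp)).clm_apply continuous_const
  have hproj : ∀ x : EuclideanSpace ℝ (Fin d), HasFDerivAt (fun x : EuclideanSpace ℝ (Fin d) => x i)
      (EuclideanSpace.proj i : EuclideanSpace ℝ (Fin d) →L[ℝ] ℝ) x :=
    fun x => (EuclideanSpace.proj i : EuclideanSpace ℝ (Fin d) →L[ℝ] ℝ).hasFDerivAt
  have hci : Continuous fun x : EuclideanSpace ℝ (Fin d) => x i :=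
    (EuclideanSpace.proj i : EuclideanSpace ℝ (Fin d) →L[ℝ] ℝ).continuous
  have hsq : ∀ x, fderiv ℝ (fun x => f x ^ 2) x e = 2 * f x * fderiv ℝ f x e := by
    intro x
    rw [((hdf x).hasFDerivAt.pow 2).fderiv]
    simp
  have hsc : HasCompactSupport fun x => f x ^ 2 := by
    have := hc.comp_left (g := fun t : ℝ => t ^ 2) (by simp)
    exact this
  have hpr : ∀ x, fderiv ℝ (fun x : EuclideanSpace ℝ (Fin d) => x i) x e = 1 := by
    intro x
    rw [(hproj x).fderiv]
    simp [he]
  have hint2 : Integrable fun x => f x ^ 2 :=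
    (hfc.pow 2).integrable_of_hasCompactSupport hsc
  have hint3 : Integrable fun x => x i * (2 * f x * fderiv ℝ f x e) := by
    refine Continuous.integrable_of_hasCompactSupport (by fun_prop) (hc.mono fun x hx hfx => hx ?_)
    simp [hfx]
  have hint4 : Integrable fun x => ‖gradient f x‖ ^ 2 := by
    refine Continuous.integrable_of_hasCompactSupport ((continuous_gradient hf).norm.pow 2) ?_
    exact (hasCompactSupport_gradient hc).comp_left
      (g := fun v : EuclideanSpace ℝ (Fin d) => ‖v‖ ^ 2) (by simp)
  have key := integral_mul_fderiv_eq_neg_fderiv_mul_of_integrable (𝕜 := ℝ)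
    (μ := (volume : Measure (EuclideanSpace ℝ (Fin d))))
    (f := fun x : EuclideanSpace ℝ (Fin d) => x i) (g := fun x => f x ^ 2) (v := e)
    (by simpa only [hpr, one_mul] using hint2) (by simpa only [hsq] using hint3)
    (by
      refine Continuous.integrable_of_hasCompactSupport (by fun_prop) (hc.mono fun x hx hfx => hx ?_)
      simp [hfx])
    (fun x _ => (hproj x).differentiableAt) (fun x _ => (hdf x).pow 2)
  simp only [hpr, one_mul, hsq] at key
  -- Young's inequality; half of `∫ f²` is absorbed on the left
  have hle : ∫ x, -(x i * (2 * f x * fderiv ℝ f x e)) ≤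
      ∫ x, (1 / 2 * f x ^ 2 + 2 * R ^ 2 * ‖gradient f x‖ ^ 2) := by
    refine integral_mono hint3.neg ((hint2.const_mul _).add (hint4.const_mul _)) fun x => ?_
    by_cases hx : x ∈ D
    · have h1 : |x i| ≤ R := (PiLp.norm_apply_le x i).trans (hR x hx)
      have h2 : |fderiv ℝ f x e| ≤ ‖gradient f x‖ := by
        rw [norm_gradient]
        simpa [he] using (fderiv ℝ f x).le_opNorm e
      have h3 : |x i * fderiv ℝ f x e| ≤ R * ‖gradient f x‖ := by
        rw [abs_mul]
        exact mul_le_mul h1 h2 (abs_nonneg _) ((abs_nonneg _).trans h1)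
      have h4 : (x i * fderiv ℝ f x e) ^ 2 ≤ (R * ‖gradient f x‖) ^ 2 :=
        sq_le_sq' (by linarith [neg_abs_le (x i * fderiv ℝ f x e)]) ((le_abs_self _).trans h3)
      have h5 := sq_nonneg (f x + 2 * (x i * fderiv ℝ f x e))
      simp only
      nlinarith
    · have h0 : f x = 0 := by
        by_contra h
        exact hx (hs (subset_tsupport f h))
      simp only [h0]
      simp only [mul_zero, zero_mul, neg_zero]
      positivity
  rw [integral_neg, key, neg_neg, integral_add (hint2.const_mul _) (hint4.const_mul _),
    integral_const_mul, integral_const_mul] at hle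
  linarith

/-- Poincaré's inequality on a bounded domain. -/
theorem exists_norm_val_le (hd : 0 < d) (hDb : Bornology.IsBounded D) :
    ∃ C : ℝ, 0 ≤ C ∧ ∀ v : H10 D, ‖val v‖ ≤ C * ‖grad v‖ := by
  obtain ⟨R, hR⟩ := hDb.exists_norm_le
  set R' := max R 0
  have hR' : ∀ x ∈ D, ‖x‖ ≤ R' := fun x hx => (hR x hx).trans (le_max_left _ _)
  have hR0 : 0 ≤ R' := le_max_right _ _
  refine ⟨2 * R', by positivity, fun v => ?_⟩
  have hcl : IsClosed {p : Lp ℝ 2 (domMeasure D) × Lp (EuclideanSpace ℝ (Fin d)) 2 (domMeasure D) |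
      ‖p.1‖ ≤ 2 * R' * ‖p.2‖} :=
    isClosed_le (by fun_prop) (by fun_prop)
  have hv : (v.1 : Lp ℝ 2 (domMeasure D) × Lp (EuclideanSpace ℝ (Fin d)) 2 (domMeasure D)) ∈
      closure (testGraph D : Set (Lp ℝ 2 (domMeasure D) ×
        Lp (EuclideanSpace ℝ (Fin d)) 2 (domMeasure D))) := v.2
  refine closure_minimal ?_ hcl hv
  rintro p ⟨f, hf, hc, hs, h1, h2⟩
  have h0 : ∀ x ∉ D, f x = 0 := fun x hx => by
    by_contra h
    exact hx (hs (subset_tsupport f h))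
  have h0' : ∀ x ∉ D, gradient f x = 0 := fun x hx => by
    have : x ∉ tsupport (fderiv ℝ f) := fun h => hx (hs (tsupport_fderiv_subset ℝ h))
    simp [gradient, image_eq_zero_of_notMem_tsupport this]
  have e1 : ‖p.1‖ ^ 2 = ∫ x, f x ^ 2 := by
    rw [norm_sq_Lp_two, ← setIntegral_eq_integral_of_forall_compl_eq_zero (s := D)
      (f := fun x => f x ^ 2) (fun x hx => by simp [h0 x hx])]
    refine integral_congr_ae (h1.mono fun x hx => ?_)
    simp [hx]
  have e2 : ‖p.2‖ ^ 2 = ∫ x, ‖gradient f x‖ ^ 2 := by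
    rw [norm_sq_Lp_two, ← setIntegral_eq_integral_of_forall_compl_eq_zero (s := D)
      (f := fun x => ‖gradient f x‖ ^ 2) (fun x hx => by simp [h0' x hx])]
    refine integral_congr_ae (h2.mono fun x hx => ?_)
    simp [hx]
  have h := integral_sq_le_of_test ⟨0, hd⟩ hR' hf hc hs
  rw [← e1, ← e2] at h
  have h0 : 0 ≤ 2 * R' * ‖p.2‖ := by positivity
  have h3 : ‖p.1‖ ^ 2 ≤ (2 * R' * ‖p.2‖) ^ 2 := by linarith [mul_pow (2 * R') ‖p.2‖ 2]
  exact (abs_le_of_sq_le_sq' h3 h0).2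

lemma isClosed_range_grad (hd : 0 < d) (hDb : Bornology.IsBounded D) :
    IsClosed (LinearMap.range (grad (D := D)) :
      Set (Lp (EuclideanSpace ℝ (Fin d)) 2 (domMeasure D))) := by
  obtain ⟨C, hC, h⟩ := exists_norm_val_le hd hDb
  let g : (testGraph D).topologicalClosure →L[ℝ] Lp (EuclideanSpace ℝ (Fin d)) 2 (domMeasure D) :=
    (ContinuousLinearMap.snd ℝ _ _).comp (testGraph D).topologicalClosure.subtypeL
  have hg : AntilipschitzWith (Real.toNNReal (max C 1)) g := by
    refine AddMonoidHomClass.antilipschitz_of_bound g fun v => ?_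
    rw [Real.coe_toNNReal _ (by positivity)]
    refine max_le ?_ ?_
    · exact (h v).trans (mul_le_mul_of_nonneg_right (le_max_left _ _) (norm_nonneg _))
    · exact le_mul_of_one_le_left (norm_nonneg _) (le_max_right _ _)
  have : CompleteSpace (testGraph D).topologicalClosure :=
    (Submodule.isClosed_topologicalClosure _).completeSpace_coe
  have := hg.isClosed_range g.uniformContinuous
  exact this

lemma grad_injective (hd : 0 < d) (hDb : Bornology.IsBounded D) :
    Function.Injective (grad (D := D)) := by
  obtain ⟨C, hC, h⟩ := exists_norm_val_le hd hDb
  refine (injective_iff_map_eq_zero _).2 fun v hv => ext_of_val_grad ?_ (by simpa using hv)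
  have := h v
  rw [hv, norm_zero, mul_zero] at this
  simpa using this

/-- On a zero-dimensional domain `‖∇v‖` vanishes, hence so does the dual space. -/
lemma dim_pos_of_ne_zero {G : Hneg1 D} (hG : G ≠ 0) : 0 < d := by
  by_contra hd
  obtain rfl : d = 0 := by omega
  refine hG (ContinuousLinearMap.ext fun v => ?_)
  have h0 : grad v = 0 := by
    refine Lp.ext (Filter.Eventually.of_forall fun x => Subsingleton.elim _ _)
  have := G.le_opNorm v
  rw [norm_eq_norm_grad, h0, norm_zero, mul_zero] at this
  simpa using this

end H10

/-! ### Multiplication by bounded functions -/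

section Multiplication

variable {d : ℕ} {μ : Measure (EuclideanSpace ℝ (Fin d))}

/-- Multiplication of `L²` vector fields by `L^∞` functions. -/
noncomputable def mulL : Lp ℝ ∞ μ →L[ℝ]
    Lp (EuclideanSpace ℝ (Fin d)) 2 μ →L[ℝ] Lp (EuclideanSpace ℝ (Fin d)) 2 μ :=
  (ContinuousLinearMap.lsmul ℝ ℝ).holderL μ ∞ 2 2

lemma coeFn_mulL (W : Lp ℝ ∞ μ) (p : Lp (EuclideanSpace ℝ (Fin d)) 2 μ) :
    mulL W p =ᵐ[μ] fun x => W x • p x :=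
  ContinuousLinearMap.coeFn_holder _ W p

lemma norm_mulL_le (W : Lp ℝ ∞ μ) (p : Lp (EuclideanSpace ℝ (Fin d)) 2 μ) :
    ‖mulL W p‖ ≤ ‖W‖ * ‖p‖ := by
  refine (ContinuousLinearMap.norm_holder_apply_apply_le
    (ContinuousLinearMap.lsmul ℝ ℝ) W p).trans ?_
  have : ‖(ContinuousLinearMap.lsmul ℝ ℝ :
      ℝ →L[ℝ] EuclideanSpace ℝ (Fin d) →L[ℝ] EuclideanSpace ℝ (Fin d))‖ ≤ 1 :=
    ContinuousLinearMap.opNorm_lsmul_le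
  rw [mul_assoc]
  exact mul_le_of_le_one_left (by positivity) this

lemma inner_mulL (W : Lp ℝ ∞ μ) (p q : Lp (EuclideanSpace ℝ (Fin d)) 2 μ) :
    inner ℝ (mulL W p) q = ∫ x, W x * inner ℝ (p x) (q x) ∂μ := by
  rw [L2.inner_def]
  refine integral_congr_ae ((coeFn_mulL W p).mono fun x hx => ?_)
  simp [hx, real_inner_smul_left]

lemma integrable_mul_inner (W : Lp ℝ ∞ μ) (p q : Lp (EuclideanSpace ℝ (Fin d)) 2 μ) :
    Integrable (fun x => W x * inner ℝ (p x) (q x)) μ := by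
  refine (L2.integrable_inner (𝕜 := ℝ) (mulL W p) q).congr ((coeFn_mulL W p).mono fun x hx => ?_)
  simp [hx, real_inner_smul_left]

lemma inner_mulL_comm (W : Lp ℝ ∞ μ) (p q : Lp (EuclideanSpace ℝ (Fin d)) 2 μ) :
    inner ℝ (mulL W p) q = inner ℝ (mulL W q) p := by
  rw [inner_mulL, inner_mulL]
  simp_rw [real_inner_comm]

lemma mul_norm_sq_le_inner_mulL {W : Lp ℝ ∞ μ} {c : ℝ} (hW : ∀ᵐ x ∂μ, c ≤ W x)
    (p : Lp (EuclideanSpace ℝ (Fin d)) 2 μ) : c * ‖p‖ ^ 2 ≤ inner ℝ (mulL W p) p := by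
  rw [inner_mulL, norm_sq_Lp_two, ← integral_const_mul]
  refine integral_mono_ae ?_ (integrable_mul_inner W p p) (hW.mono fun x hx => ?_)
  · have := (L2.integrable_inner (𝕜 := ℝ) p p).const_mul c
    simpa using this
  · simp only [real_inner_self_eq_norm_sq]
    gcongr

lemma inner_mulL_self_mono {W : Lp ℝ ∞ μ} (hW : ∀ᵐ x ∂μ, 0 ≤ W x)
    {p q : Lp (EuclideanSpace ℝ (Fin d)) 2 μ} (hpq : ∀ᵐ x ∂μ, ‖p x‖ ≤ ‖q x‖) :
    inner ℝ (mulL W p) p ≤ inner ℝ (mulL W q) q := by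
  rw [inner_mulL, inner_mulL]
  refine integral_mono_ae (integrable_mul_inner W p p) (integrable_mul_inner W q q) ?_
  filter_upwards [hW, hpq] with x h1 h2
  simp only [real_inner_self_eq_norm_sq]
  gcongr

lemma inner_mulL_self_le (W : Lp ℝ ∞ μ) (p : Lp (EuclideanSpace ℝ (Fin d)) 2 μ) :
    inner ℝ (mulL W p) p ≤ ‖W‖ * ‖p‖ ^ 2 := by
  refine (real_inner_le_norm _ _).trans ?_
  rw [pow_two, ← mul_assoc]
  gcongr
  exact norm_mulL_le W p

end Multiplication

/-! ### A weak maximum principle -/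

/-- A smooth function `Ψ` with `Ψ(x) = x` for `x ≥ 0`, `Ψ(x) > x` for `x < 0` and `|Ψ'| ≤ 1`: a
smooth substitute for `x ↦ |x|`. -/
noncomputable def smoothFold (x : ℝ) : ℝ := x + expNegInvGlue (-x)

namespace smoothFold

lemma zero : smoothFold 0 = 0 := by simp [smoothFold]

lemma le_self (x : ℝ) : x ≤ smoothFold x := by
  simpa [smoothFold] using expNegInvGlue.nonneg (-x)

lemma nonneg_of_eq {x : ℝ} (h : smoothFold x = x) : 0 ≤ x := by
  simpa [smoothFold] using h

lemma contDiff : ContDiff ℝ ∞ smoothFold :=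
  contDiff_id.add (expNegInvGlue.contDiff.comp contDiff_neg)

lemma exists_hasDerivAt (x : ℝ) : ∃ c, |c| ≤ 1 ∧ HasDerivAt smoothFold c x := by
  have h := expNegInvGlue.hasDerivAt_polynomial_eval_inv_mul 1 (-x)
  simp only [Polynomial.eval_one, one_mul, Polynomial.derivative_one, sub_zero, mul_one,
    Polynomial.eval_pow, Polynomial.eval_X] at h
  refine ⟨_, ?_, (hasDerivAt_id x).add (h.comp x (hasDerivAt_neg x))⟩
  have h0 : 0 ≤ (-x)⁻¹ ^ 2 * expNegInvGlue (-x) := by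
    have := expNegInvGlue.nonneg (-x)
    positivity
  have h2 : (-x)⁻¹ ^ 2 * expNegInvGlue (-x) ≤ 2 := by
    rcases le_or_gt (-x) 0 with hx | hx
    · rw [expNegInvGlue.zero_of_nonpos hx]; norm_num
    · have hy : 0 < (-x)⁻¹ := inv_pos.2 hx
      set y := (-x)⁻¹
      have he : expNegInvGlue (-x) = (Real.exp y)⁻¹ := by
        rw [expNegInvGlue, if_neg hx.not_ge, Real.exp_neg]
      rw [he, ← div_eq_mul_inv, div_le_iff₀ (Real.exp_pos _)]
      nlinarith [Real.quadratic_le_exp_of_nonneg hy.le]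
  rw [abs_le]
  constructor <;> linarith

lemma lipschitzWith : LipschitzWith 1 smoothFold := by
  refine lipschitzWith_of_nnnorm_deriv_le (contDiff.differentiable (by simp)) fun x => ?_
  obtain ⟨c, hc, h⟩ := exists_hasDerivAt x
  rw [h.deriv, ← NNReal.coe_le_coe]
  simpa using hc

end smoothFold

namespace H10

variable {d : ℕ} {D : Set (EuclideanSpace ℝ (Fin d))}

lemma IsTest.exists_smoothFold {v : H10 D} {f : EuclideanSpace ℝ (Fin d) → ℝ} (hf : IsTest v f) :
    ∃ v' : H10 D, val v' =ᵐ[domMeasure D] (fun x => smoothFold (val v x)) ∧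
      ∀ᵐ x ∂(domMeasure D), ‖grad v' x‖ ≤ ‖grad v x‖ := by
  have hsub : tsupport (smoothFold ∘ f) ⊆ tsupport f :=
    closure_mono (Function.support_comp_subset smoothFold.zero f)
  obtain ⟨v', h⟩ := exists_isTest (D := D) (smoothFold.contDiff.comp hf.contDiff)
    (hf.hasCompactSupport.comp_left smoothFold.zero) (hsub.trans hf.tsupport_subset)
  refine ⟨v', ?_, ?_⟩
  · filter_upwards [h.val_ae, hf.val_ae] with x h1 h2
    rw [h1, h2]
    rfl
  · filter_upwards [h.grad_ae, hf.grad_ae] with x h1 h2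
    rw [h1, h2, norm_gradient, norm_gradient]
    obtain ⟨c, hc, hd⟩ := smoothFold.exists_hasDerivAt (f x)
    have hfx : DifferentiableAt ℝ f x := hf.contDiff.differentiable (by simp) x
    rw [(hd.comp_hasFDerivAt x hfx.hasFDerivAt).fderiv, norm_smul]
    exact mul_le_of_le_one_left (norm_nonneg _) hc

/-- The weak maximum principle: the solution `p` of the equation with a positive functional as its
source is nonnegative. If `f` is a test function close to `p`, then the energy of `p - Ψ(f)` is at
most that of `p - f`, where `Ψ = smoothFold`; hence `Ψ(p) = p`. -/
theorem val_nonneg_of_isPositiveFunctional (hd : 0 < d) (hDb : Bornology.IsBounded D)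
    {W : Lp ℝ ∞ (domMeasure D)} {c : ℝ} (hc : 0 < c) (hW : ∀ᵐ x ∂(domMeasure D), c ≤ W x)
    {G : Hneg1 D} (hG : IsPositiveFunctional G) {p : H10 D}
    (hp : ∀ v : H10 D, inner ℝ (mulL W (grad p)) (grad v) = G v) :
    ∀ᵐ x ∂(domMeasure D), 0 ≤ val p x := by
  obtain ⟨C, hC, hpoin⟩ := exists_norm_val_le hd hDb
  set Ψp := smoothFold.lipschitzWith.compLp smoothFold.zero (val p) with hΨp
  have hsmall : ∀ ε : ℝ, 0 < ε → ‖val p - Ψp‖ ≤ (C * √(‖W‖ / c) + 1) * ε := by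
    intro ε hε
    obtain ⟨v, f, hf, hv1, hv2⟩ := exists_isTest_near p hε
    obtain ⟨v', h1, h2⟩ := hf.exists_smoothFold
    have hGle : G v ≤ G v' := by
      rw [← sub_nonneg, ← map_sub]
      refine hG _ ?_
      have := Lp.coeFn_sub (val v') (val v)
      rw [map_sub]
      filter_upwards [this, h1] with x e1 e2
      rw [e1, Pi.sub_apply, e2, sub_nonneg]
      exact smoothFold.le_self _
    -- as `p` has source `G`, the energy of `p - v` is affine in `G v` and the energy of `v`
    have hexp : ∀ v : H10 D, inner ℝ (mulL W (grad (p - v))) (grad (p - v)) =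
        G p - 2 * G v + inner ℝ (mulL W (grad v)) (grad v) := by
      intro v
      have e1 := hp v
      have e2 := inner_mulL_comm W (grad v) (grad p)
      simp only [map_sub, inner_sub_left, inner_sub_right, hp p, e2, e1]
      ring
    have hen : inner ℝ (mulL W (grad (p - v'))) (grad (p - v'))
        ≤ inner ℝ (mulL W (grad (p - v))) (grad (p - v)) := by
      rw [hexp, hexp]
      have := inner_mulL_self_mono (hW.mono fun x hx => hc.le.trans hx) h2
      linarith
    have hgrad : ‖grad (p - v')‖ ≤ √(‖W‖ / c) * ε := by
      have e1 := (mul_norm_sq_le_inner_mulL hW (grad (p - v'))).trans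
        (hen.trans (inner_mulL_self_le W _))
      rw [← Real.sqrt_sq hε.le, ← Real.sqrt_mul (by positivity)]
      refine Real.le_sqrt_of_sq_le ?_
      rw [div_mul_eq_mul_div, le_div_iff₀ hc, mul_comm]
      refine e1.trans ?_
      rw [map_sub]
      gcongr
    have hv' : val v' = smoothFold.lipschitzWith.compLp smoothFold.zero (val v) := by
      refine Lp.ext (h1.trans ?_)
      exact (smoothFold.lipschitzWith.coeFn_compLp smoothFold.zero (val v)).symm
    have hlip : ‖val v' - Ψp‖ ≤ ε := by
      rw [hv', hΨp]
      refine (smoothFold.lipschitzWith.norm_compLp_sub_le smoothFold.zero _ _).trans ?_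
      rw [NNReal.coe_one, one_mul, norm_sub_rev]
      exact hv1.le
    calc ‖val p - Ψp‖ = ‖val (p - v') + (val v' - Ψp)‖ := by rw [map_sub]; congr 1; abel
      _ ≤ ‖val (p - v')‖ + ‖val v' - Ψp‖ := norm_add_le _ _
      _ ≤ C * (√(‖W‖ / c) * ε) + ε := by
        gcongr
        exact (hpoin _).trans (by gcongr)
      _ = _ := by ring
  have hzero : ‖val p - Ψp‖ ≤ 0 := by
    refine le_of_forall_pos_le_add fun ε hε => ?_
    have hpos : 0 < C * √(‖W‖ / c) + 1 := by positivity
    refine (hsmall (ε / (C * √(‖W‖ / c) + 1)) (by positivity)).trans (le_of_eq ?_)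
    field_simp
    ring
  have heq : Ψp = val p := (sub_eq_zero.1 (norm_le_zero_iff.1 hzero)).symm
  have hae := LipschitzWith.coeFn_compLp smoothFold.lipschitzWith smoothFold.zero (val p)
  rw [← hΨp, heq] at hae
  exact hae.mono fun x hx => smoothFold.nonneg_of_eq hx.symm

end H10

/-! ### The coefficient as a smooth function with values in `L^∞` -/

section Weight

variable {d s : ℕ} {D : Set (EuclideanSpace ℝ (Fin d))}

lemma coeFn_Lp_sum {X F ι : Type*} [MeasurableSpace X] {μ : Measure X} [NormedAddCommGroup F]
    {p : ℝ≥0∞} (t : Finset ι) (f : ι → Lp F p μ) :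
    ⇑(∑ i ∈ t, f i) =ᵐ[μ] fun x => ∑ i ∈ t, f i x := by
  classical
  induction t using Finset.induction_on with
  | empty =>
    simp only [Finset.sum_empty]
    exact Lp.coeFn_zero F p μ
  | insert i t hi ih =>
    rw [Finset.sum_insert hi]
    filter_upwards [Lp.coeFn_add (f i) (∑ i ∈ t, f i), ih] with x h1 h2
    rw [h1, Pi.add_apply, h2, Finset.sum_insert hi]

lemma norm_Lp_top_le_of_ae_bound {X F : Type*} [MeasurableSpace X] {μ : Measure X}
    [NormedAddCommGroup F] {f : Lp F ∞ μ} {C : ℝ} (hC : 0 ≤ C) (h : ∀ᵐ x ∂μ, ‖f x‖ ≤ C) :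
    ‖f‖ ≤ C := by
  rw [Lp.norm_def, eLpNorm_exponent_top]
  exact ENNReal.toReal_le_of_le_ofReal hC (eLpNormEssSup_le_of_ae_bound h)

lemma ae_norm_le_norm_Lp_top {X F : Type*} [MeasurableSpace X] {μ : Measure X}
    [NormedAddCommGroup F] (f : Lp F ∞ μ) : ∀ᵐ x ∂μ, ‖f x‖ ≤ ‖f‖ := by
  filter_upwards [ae_le_eLpNormEssSup (f := f) (μ := μ)] with x hx
  rw [Lp.norm_def, eLpNorm_exponent_top, ← toReal_enorm]
  refine ENNReal.toReal_mono ?_ hx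
  rw [← eLpNorm_exponent_top]
  exact Lp.eLpNorm_ne_top f

/-- The function `∏_{j ∈ S} a_j(x) · a(x, z)`, which is the derivative of the coefficient `a(x, z)`
along the word `S` of directions. -/
noncomputable def weightFun (a : Fin s → Lp ℝ ∞ (domMeasure D)) (S : List (Fin s))
    (z : Fin s → ℝ) (x : EuclideanSpace ℝ (Fin d)) : ℝ :=
  (S.map fun j => a j x).prod * coeff a z x

lemma ae_abs_prod_le (a : Fin s → Lp ℝ ∞ (domMeasure D)) :
    ∀ᵐ x ∂(domMeasure D), (∀ j, |a j x| ≤ ‖a j‖) ∧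
      ∀ S : List (Fin s), |(S.map fun j => a j x).prod| ≤ (S.map fun j => ‖a j‖).prod := by
  have h : ∀ᵐ x ∂(domMeasure D), ∀ j, ‖a j x‖ ≤ ‖a j‖ :=
    ae_all_iff.2 fun j => ae_norm_le_norm_Lp_top (a j)
  refine h.mono fun x hx => ⟨hx, fun S => ?_⟩
  induction S with
  | nil => simp
  | cons j S ih =>
    rw [List.map_cons, List.prod_cons, List.map_cons, List.prod_cons, abs_mul]
    exact mul_le_mul (hx j) ih (abs_nonneg _) (norm_nonneg _)

lemma coeff_le {a : Fin s → Lp ℝ ∞ (domMeasure D)} {x : EuclideanSpace ℝ (Fin d)}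
    (hx : ∀ j, |a j x| ≤ ‖a j‖) (z : Fin s → ℝ) :
    coeff a z x ≤ Real.exp (∑ j, |z j| * ‖a j‖) := by
  refine Real.exp_le_exp.2 (Finset.sum_le_sum fun j _ => ?_)
  refine (le_abs_self _).trans ?_
  rw [abs_mul]
  gcongr
  exact hx j

lemma memLp_weightFun (a : Fin s → Lp ℝ ∞ (domMeasure D)) (S : List (Fin s)) (z : Fin s → ℝ) :
    MemLp (weightFun a S z) ∞ (domMeasure D) := by
  refine memLp_top_of_bound ?_ ((S.map fun j => ‖a j‖).prod * Real.exp (∑ j, |z j| * ‖a j‖)) ?_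
  · have hm : ∀ j, AEStronglyMeasurable (a j) (domMeasure D) :=
      fun j => Lp.aestronglyMeasurable (a j)
    refine AEStronglyMeasurable.mul ?_ ?_
    · induction S with
      | nil => simpa using aestronglyMeasurable_const
      | cons j S ih =>
        simp only [List.map_cons, List.prod_cons]
        exact (hm j).mul ih
    · refine Real.continuous_exp.comp_aestronglyMeasurable ?_
      exact Finset.aestronglyMeasurable_fun_sum _ fun j _ => (hm j).const_mul _
  · filter_upwards [ae_abs_prod_le a] with x hx
    rw [weightFun, Real.norm_eq_abs, abs_mul, coeff, Real.abs_exp]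
    exact mul_le_mul (hx.2 S) (coeff_le hx.1 z) (Real.exp_nonneg _)
      ((abs_nonneg _).trans (hx.2 S))

/-- The class of `weightFun a S z` in `L^∞(D)`. -/
noncomputable def weight (a : Fin s → Lp ℝ ∞ (domMeasure D)) (S : List (Fin s))
    (z : Fin s → ℝ) : Lp ℝ ∞ (domMeasure D) :=
  (memLp_weightFun a S z).toLp _

lemma coeFn_weight (a : Fin s → Lp ℝ ∞ (domMeasure D)) (S : List (Fin s)) (z : Fin s → ℝ) :
    weight a S z =ᵐ[domMeasure D] weightFun a S z :=
  (memLp_weightFun a S z).coeFn_toLp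

lemma coeFn_weight_nil (a : Fin s → Lp ℝ ∞ (domMeasure D)) (z : Fin s → ℝ) :
    weight a [] z =ᵐ[domMeasure D] coeff a z := by
  refine (coeFn_weight a [] z).trans (Filter.Eventually.of_forall fun x => ?_)
  simp [weightFun]

lemma prod_map_norm_nonneg (a : Fin s → Lp ℝ ∞ (domMeasure D)) (S : List (Fin s)) :
    0 ≤ (S.map fun j => ‖a j‖).prod :=
  List.prod_nonneg fun y hy => by
    obtain ⟨j, -, rfl⟩ := List.mem_map.1 hy
    exact norm_nonneg _

lemma norm_weight_zero_le (a : Fin s → Lp ℝ ∞ (domMeasure D)) (S : List (Fin s)) :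
    ‖weight a S 0‖ ≤ (S.map fun j => ‖a j‖).prod := by
  refine norm_Lp_top_le_of_ae_bound (prod_map_norm_nonneg a S) ?_
  filter_upwards [coeFn_weight a S 0, ae_abs_prod_le a] with x h1 h2
  rw [h1, Real.norm_eq_abs]
  simpa [weightFun, coeff] using h2.2 S

/-- The second-order Taylor estimate for `z ↦ ∏_{j ∈ S} a_j · a(·, z)` in `L^∞`. -/
lemma norm_weight_sub_le (a : Fin s → Lp ℝ ∞ (domMeasure D)) (S : List (Fin s)) (z z' : Fin s → ℝ)
    (hz : (∑ j, ‖a j‖) * ‖z' - z‖ ≤ 1) :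
    ‖weight a S z' - weight a S z - ∑ j, (z' j - z j) • weight a (j :: S) z‖ ≤
      (S.map fun j => ‖a j‖).prod * Real.exp (∑ j, |z j| * ‖a j‖) * (∑ j, ‖a j‖) ^ 2
        * ‖z' - z‖ ^ 2 := by
  have hP := prod_map_norm_nonneg a S
  refine norm_Lp_top_le_of_ae_bound (by positivity) ?_
  have hsm : ∀ᵐ x ∂(domMeasure D), ∀ j, ((z' j - z j) • weight a (j :: S) z :
      Lp ℝ ∞ (domMeasure D)) x = (z' j - z j) * weightFun a (j :: S) z x := by
    refine ae_all_iff.2 fun j => ?_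
    filter_upwards [Lp.coeFn_smul (z' j - z j) (weight a (j :: S) z), coeFn_weight a (j :: S) z]
      with x h1 h2
    rw [h1, Pi.smul_apply, h2, smul_eq_mul]
  filter_upwards [Lp.coeFn_sub (weight a S z' - weight a S z)
      (∑ j, (z' j - z j) • weight a (j :: S) z), Lp.coeFn_sub (weight a S z') (weight a S z),
    coeFn_Lp_sum Finset.univ (fun j => (z' j - z j) • weight a (j :: S) z),
    coeFn_weight a S z, coeFn_weight a S z', hsm, ae_abs_prod_le a] with x h1 h2 h3 h4 h5 h6 h7
  set X : ℝ := ∑ j, (z' j - z j) * a j x with hX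
  have hXle : |X| ≤ (∑ j, ‖a j‖) * ‖z' - z‖ := by
    rw [Finset.sum_mul]
    refine (Finset.abs_sum_le_sum_abs _ _).trans (Finset.sum_le_sum fun j _ => ?_)
    rw [abs_mul, mul_comm]
    exact mul_le_mul (h7.1 j) (norm_le_pi_norm (z' - z) j) (abs_nonneg _) (norm_nonneg _)
  have hval : (weight a S z' - weight a S z - ∑ j, (z' j - z j) • weight a (j :: S) z :
      Lp ℝ ∞ (domMeasure D)) x =
      (S.map fun j => a j x).prod * coeff a z x * (Real.exp X - 1 - X) := by
    rw [h1, Pi.sub_apply, h2, Pi.sub_apply, h3, h4, h5]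
    simp only [h6, weightFun, List.map_cons, List.prod_cons]
    have e1 : coeff a z' x = coeff a z x * Real.exp X := by
      rw [coeff, coeff, ← Real.exp_add, hX, ← Finset.sum_add_distrib]
      congr 1
      exact Finset.sum_congr rfl fun j _ => by ring
    have e2 : ∑ j, (z' j - z j) * (a j x * (S.map fun j => a j x).prod * coeff a z x)
        = (S.map fun j => a j x).prod * coeff a z x * X := by
      rw [hX, Finset.mul_sum]
      exact Finset.sum_congr rfl fun j _ => by ring
    rw [e1, e2]
    ring
  rw [hval, Real.norm_eq_abs, abs_mul, abs_mul]
  have e3 : |Real.exp X - 1 - X| ≤ (∑ j, ‖a j‖) ^ 2 * ‖z' - z‖ ^ 2 := by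
    refine (Real.abs_exp_sub_one_sub_id_le (hXle.trans hz)).trans ?_
    rw [← mul_pow, ← sq_abs]
    gcongr
  have e4 : |coeff a z x| ≤ Real.exp (∑ j, |z j| * ‖a j‖) := by
    rw [coeff, Real.abs_exp]
    exact coeff_le h7.1 z
  rw [mul_assoc _ (_ ^ 2) (_ ^ 2)]
  exact mul_le_mul (mul_le_mul (h7.2 S) e4 (abs_nonneg _) hP) e3 (abs_nonneg _) (by positivity)

lemma hasFDerivAt_weight (a : Fin s → Lp ℝ ∞ (domMeasure D)) (S : List (Fin s)) (z : Fin s → ℝ) :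
    HasFDerivAt (weight a S)
      (∑ j, (ContinuousLinearMap.proj j : (Fin s → ℝ) →L[ℝ] ℝ).smulRight (weight a (j :: S) z))
      z := by
  refine HasFDerivAt.of_isLittleO ?_
  refine Asymptotics.IsBigO.trans_isLittleO ?_ (Asymptotics.isLittleO_pow_sub_sub z one_lt_two)
  refine Asymptotics.IsBigO.of_bound
    ((S.map fun j => ‖a j‖).prod * Real.exp (∑ j, |z j| * ‖a j‖) * (∑ j, ‖a j‖) ^ 2) ?_
  have hnear : ∀ᶠ z' in nhds z, (∑ j, ‖a j‖) * ‖z' - z‖ < 1 := by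
    have hc : Continuous fun z' : Fin s → ℝ => (∑ j, ‖a j‖) * ‖z' - z‖ := by fun_prop
    exact hc.continuousAt.eventually_lt_const (by simp)
  filter_upwards [hnear] with z' hz'
  have h := norm_weight_sub_le a S z z' hz'.le
  rw [norm_pow, norm_norm]
  simpa using h

lemma contDiff_weight (a : Fin s → Lp ℝ ∞ (domMeasure D)) (S : List (Fin s)) :
    ContDiff ℝ ∞ (weight a S) := by
  rw [contDiff_infty]
  intro n
  induction n generalizing S with
  | zero =>
    exact contDiff_zero.2 (continuous_iff_continuousAt.2
      fun z => (hasFDerivAt_weight a S z).continuousAt)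
  | succ n ih =>
    rw [Nat.cast_succ, contDiff_succ_iff_fderiv]
    refine ⟨fun z => (hasFDerivAt_weight a S z).differentiableAt, by simp, ?_⟩
    have e : fderiv ℝ (weight a S) = fun z => ∑ j,
        (ContinuousLinearMap.proj j : (Fin s → ℝ) →L[ℝ] ℝ).smulRight (weight a (j :: S) z) :=
      funext fun z => (hasFDerivAt_weight a S z).fderiv
    rw [e]
    exact ContDiff.sum fun j _ => contDiff_const.smulRight (ih (j :: S))

lemma fderiv_weight_single (a : Fin s → Lp ℝ ∞ (domMeasure D)) (S : List (Fin s)) (z : Fin s → ℝ)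
    (j : Fin s) : fderiv ℝ (weight a S) z (Pi.single j 1) = weight a (j :: S) z := by
  rw [(hasFDerivAt_weight a S z).fderiv]
  simp [Pi.single_apply]

/-- In terms of the energy density `√a(·, z) p`, multiplication by `∏_{j ∈ S} a_j · a(·, z)` is
multiplication by `∏_{j ∈ S} a_j`. -/
lemma inner_mulL_weight (a : Fin s → Lp ℝ ∞ (domMeasure D)) (S : List (Fin s)) (z : Fin s → ℝ)
    (p q : Lp (EuclideanSpace ℝ (Fin d)) 2 (domMeasure D)) :
    inner ℝ (mulL (weight a S z) p) q =
      inner ℝ (mulL (weight a S 0) (mulL (weight a [] ((1 / 2 : ℝ) • z)) p))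
        (mulL (weight a [] ((1 / 2 : ℝ) • z)) q) := by
  rw [inner_mulL, inner_mulL]
  refine integral_congr_ae ?_
  filter_upwards [coeFn_weight a S z, coeFn_weight a S 0, coeFn_weight_nil a ((1 / 2 : ℝ) • z),
    coeFn_mulL (weight a [] ((1 / 2 : ℝ) • z)) p, coeFn_mulL (weight a [] ((1 / 2 : ℝ) • z)) q]
    with x h1 h2 h3 h4 h5
  have e0 : coeff a 0 x = 1 := by simp [coeff]
  have e1 : coeff a z x = coeff a ((1 / 2 : ℝ) • z) x * coeff a ((1 / 2 : ℝ) • z) x := by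
    rw [coeff, coeff, ← Real.exp_add, ← Finset.sum_add_distrib]
    congr 1
    refine Finset.sum_congr rfl fun j _ => ?_
    simp only [Pi.smul_apply, smul_eq_mul]
    ring
  rw [h1, h2, h4, h5, h3, weightFun, weightFun, e0, e1, real_inner_smul_left,
    real_inner_smul_right]
  ring

lemma abs_inner_mulL_weight_le (a : Fin s → Lp ℝ ∞ (domMeasure D)) (S : List (Fin s))
    (z : Fin s → ℝ) (p q : Lp (EuclideanSpace ℝ (Fin d)) 2 (domMeasure D)) :
    |inner ℝ (mulL (weight a S z) p) q| ≤ (S.map fun j => ‖a j‖).prod *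
      (‖mulL (weight a [] ((1 / 2 : ℝ) • z)) p‖ * ‖mulL (weight a [] ((1 / 2 : ℝ) • z)) q‖) := by
  rw [inner_mulL_weight, ← mul_assoc]
  refine (abs_real_inner_le_norm _ _).trans ?_
  gcongr
  refine (norm_mulL_le _ _).trans ?_
  gcongr
  exact norm_weight_zero_le a S

lemma inner_mulL_weight_nil_self (a : Fin s → Lp ℝ ∞ (domMeasure D)) (z : Fin s → ℝ)
    (p : Lp (EuclideanSpace ℝ (Fin d)) 2 (domMeasure D)) :
    inner ℝ (mulL (weight a [] z) p) p = ‖mulL (weight a [] ((1 / 2 : ℝ) • z)) p‖ ^ 2 := by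
  have h1 : mulL (weight a [] 0) (mulL (weight a [] ((1 / 2 : ℝ) • z)) p)
      = mulL (weight a [] ((1 / 2 : ℝ) • z)) p := by
    refine Lp.ext ?_
    filter_upwards [coeFn_mulL (weight a [] 0) (mulL (weight a [] ((1 / 2 : ℝ) • z)) p),
      coeFn_weight_nil a 0] with x h1 h2
    rw [h1, h2]
    simp [coeff]
  rw [inner_mulL_weight, h1, real_inner_self_eq_norm_sq]

end Weight

/-! ### Derivatives of an inverse along words -/

section Word

variable {s : ℕ} {A : Type*} [NormedRing A] [NormedAlgebra ℝ A]

/-- The partial derivative in the direction `j` of a function with values in a normed space. -/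
noncomputable def partialD {F : Type*} [NormedAddCommGroup F] [NormedSpace ℝ F] (j : Fin s)
    (f : (Fin s → ℝ) → F) : (Fin s → ℝ) → F :=
  fun z => fderiv ℝ f z (Pi.single j 1)

lemma contDiff_partialD {F : Type*} [NormedAddCommGroup F] [NormedSpace ℝ F] (j : Fin s)
    {f : (Fin s → ℝ) → F} (hf : ContDiff ℝ ∞ f) : ContDiff ℝ ∞ (partialD j f) :=
  (hf.fderiv_right (m := ∞) (by simp)).clm_apply contDiff_const

lemma contDiff_foldr_partialD {F : Type*} [NormedAddCommGroup F] [NormedSpace ℝ F]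
    (L : List (Fin s)) {f : (Fin s → ℝ) → F} (hf : ContDiff ℝ ∞ f) :
    ContDiff ℝ ∞ (L.foldr partialD f) := by
  induction L with
  | nil => exact hf
  | cons j L ih => exact contDiff_partialD j ih

lemma foldr_partialD_const {F : Type*} [NormedAddCommGroup F] [NormedSpace ℝ F]
    (L : List (Fin s)) (hL : L ≠ []) (c : F) : L.foldr partialD (fun _ => c) = fun _ => 0 := by
  induction L with
  | nil => exact absurd rfl hL
  | cons j L ih =>
    by_cases h : L = []
    · subst h
      funext z
      simp [partialD]
    · rw [List.foldr_cons, ih h]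
      funext z
      simp [partialD]

lemma partialD_mul (j : Fin s) {f g : (Fin s → ℝ) → A} (hf : ContDiff ℝ ∞ f)
    (hg : ContDiff ℝ ∞ g) (z : Fin s → ℝ) :
    partialD j (fun z => f z * g z) z = partialD j f z * g z + f z * partialD j g z := by
  have h1 := (hf.differentiable (by simp) z).hasFDerivAt
  have h2 := (hg.differentiable (by simp) z).hasFDerivAt
  have h3 : fderiv ℝ (fun z => f z * g z) z = _ := (h1.mul' h2).fderiv
  rw [partialD, h3]
  simp [partialD, add_comm]

variable {C : List (Fin s) → (Fin s → ℝ) → A} {R : (Fin s → ℝ) → A}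

lemma contDiff_sum_mul (hC : ∀ S, ContDiff ℝ ∞ (C S)) (hR : ContDiff ℝ ∞ R)
    (l : List (List (Fin s) × List (Fin s))) :
    ContDiff ℝ ∞ fun z => (l.map fun p => C p.1 z * p.2.foldr partialD R z).sum := by
  induction l with
  | nil => simpa using contDiff_const
  | cons p l ih =>
    simp only [List.map_cons, List.sum_cons]
    exact ((hC p.1).mul (contDiff_foldr_partialD p.2 hR)).add ih

lemma partialD_sum_mul (hC : ∀ S, ContDiff ℝ ∞ (C S))
    (hC' : ∀ j S, partialD j (C S) = C (j :: S)) (hR : ContDiff ℝ ∞ R) (j : Fin s)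
    (l : List (List (Fin s) × List (Fin s))) (z : Fin s → ℝ) :
    partialD j (fun z => (l.map fun p => C p.1 z * p.2.foldr partialD R z).sum) z =
      (l.map fun p => C (j :: p.1) z * p.2.foldr partialD R z).sum
        + (l.map fun p => C p.1 z * (j :: p.2).foldr partialD R z).sum := by
  induction l with
  | nil => simp [partialD]
  | cons p l ih =>
    have h1 := (hC p.1).mul (contDiff_foldr_partialD p.2 hR)
    have h2 := contDiff_sum_mul hC hR l
    simp only [List.map_cons, List.sum_cons]
    have h3 : partialD j (fun z => C p.1 z * p.2.foldr partialD R z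
          + (l.map fun p => C p.1 z * p.2.foldr partialD R z).sum) z
        = partialD j (fun z => C p.1 z * p.2.foldr partialD R z) z
          + partialD j (fun z => (l.map fun p => C p.1 z * p.2.foldr partialD R z).sum) z := by
      exact congrArg (fun T : (Fin s → ℝ) →L[ℝ] A => T (Pi.single j 1))
        ((h1.differentiable (by simp) z).hasFDerivAt.add
          (h2.differentiable (by simp) z).hasFDerivAt).fderiv
    rw [h3, ih, partialD_mul j (hC p.1) (contDiff_foldr_partialD p.2 hR), hC']
    simp only [List.foldr_cons]
    abel

/-- The Leibniz formula along a word `L`. -/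
lemma foldr_partialD_mul (hC : ∀ S, ContDiff ℝ ∞ (C S))
    (hC' : ∀ j S, partialD j (C S) = C (j :: S)) (hR : ContDiff ℝ ∞ R) (L : List (Fin s)) :
    L.foldr partialD (fun z => C [] z * R z) = fun z =>
      ((properSplits L ++ [([], L)]).map fun p : List (Fin s) × List (Fin s) =>
        C p.1 z * p.2.foldr partialD R z).sum := by
  induction L with
  | nil => simp [properSplits]
  | cons j L ih =>
    rw [List.foldr_cons, ih]
    funext z
    rw [partialD_sum_mul hC hC' hR]
    simp [properSplits, Function.comp_def, add_assoc]

/-- Differentiating `C R = 1` along a nonempty word. -/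
lemma sum_properSplits_add_eq_zero (hC : ∀ S, ContDiff ℝ ∞ (C S))
    (hC' : ∀ j S, partialD j (C S) = C (j :: S)) (hR : ContDiff ℝ ∞ R)
    (hCR : ∀ z, C [] z * R z = 1) {L : List (Fin s)} (hL : L ≠ []) (z : Fin s → ℝ) :
    ((properSplits L).map fun p => C p.1 z * p.2.foldr partialD R z).sum
      + C [] z * L.foldr partialD R z = 0 := by
  have h := congrFun (foldr_partialD_mul hC hC' hR L) z
  simp only [hCR, foldr_partialD_const L hL] at h
  rw [h]
  simp

/-- If the operators `C S z` are bounded by `∏_{j ∈ S} b_j` in the energy norm `N` of `C [] z`, then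
the derivative of the inverse `R` of `C []` along a word of length `n` is bounded in this norm by
`n! / (ln 2)^n`, up to the weights `b`. -/
lemma energy_foldr_partialD_le {H : Type*} [NormedAddCommGroup H] [InnerProductSpace ℝ H]
    {C : List (Fin s) → (Fin s → ℝ) → H →L[ℝ] H} {R : (Fin s → ℝ) → H →L[ℝ] H}
    (hC : ∀ S, ContDiff ℝ ∞ (C S))
    (hC' : ∀ j S, partialD j (C S) = C (j :: S)) (hR : ContDiff ℝ ∞ R)
    (hCR : ∀ z, C [] z * R z = 1) (z : Fin s → ℝ) (b : Fin s → ℝ) (hb : ∀ j, 0 ≤ b j)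
    (N : H → ℝ) (hN : ∀ p, 0 ≤ N p) (hNC : ∀ p, inner ℝ (C [] z p) p = N p ^ 2)
    (hCN : ∀ S p q, |inner ℝ (C S z p) q| ≤ (S.map b).prod * (N p * N q))
    (F : H) (L : List (Fin s)) :
    N (L.foldr partialD R z F) ≤
      (L.map b).prod * (L.length.factorial / Real.log 2 ^ L.length) * N (R z F) := by
  have hbp : ∀ S : List (Fin s), 0 ≤ (S.map b).prod := fun S => List.prod_nonneg fun y hy => by
    obtain ⟨j, -, rfl⟩ := List.mem_map.1 hy
    exact hb j
  induction hn : L.length using Nat.strong_induction_on generalizing L with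
  | _ n ih =>
  by_cases hL : L = []
  · subst hL
    simp at hn
    simp [← hn]
  set U := L.foldr partialD R z F with hU
  have h0 := congrArg (fun T : H →L[ℝ] H => inner ℝ (T F) U)
    (sum_properSplits_add_eq_zero hC hC' hR hCR hL z)
  have hmul : ∀ (S T : H →L[ℝ] H) (x : H), (S * T) x = S (T x) := fun _ _ _ => rfl
  have hsum : ∀ l : List (List (Fin s) × List (Fin s)),
      inner ℝ ((l.map fun p => C p.1 z * p.2.foldr partialD R z).sum F) U
        = (l.map fun p => inner ℝ (C p.1 z (p.2.foldr partialD R z F)) U).sum := by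
    intro l
    induction l with
    | nil => simp
    | cons p l ihl =>
      simp only [List.map_cons, List.sum_cons, add_apply, inner_add_left, ihl,
        hmul]
  simp only [add_apply, inner_add_left, hsum,
    hmul, zero_apply, inner_zero_left] at h0
  rw [← hU, hNC] at h0
  set c : ℝ := (L.map b).prod * N (R z F) * N U with hc
  have hbound : ∀ p ∈ properSplits L, -inner ℝ (C p.1 z (p.2.foldr partialD R z F)) U ≤
      c * (p.2.length.factorial / Real.log 2 ^ p.2.length) := by
    intro p hp
    refine (neg_le_abs _).trans ((hCN _ _ _).trans ?_)
    have hlt : p.2.length < n := hn ▸ length_lt_of_mem_properSplits hp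
    have h1 := ih _ hlt p.2 rfl
    calc (p.1.map b).prod * (N (p.2.foldr partialD R z F) * N U)
        ≤ (p.1.map b).prod * (((p.2.map b).prod *
            (p.2.length.factorial / Real.log 2 ^ p.2.length) * N (R z F)) * N U) := by
          have := hbp p.1
          have := hN U
          gcongr
      _ = _ := by
          rw [hc, ← prod_map_mul_of_mem_properSplits b hp]
          ring
  have hN2 : N U ^ 2 ≤ c * (n.factorial / Real.log 2 ^ n) := by
    have hc0 : 0 ≤ c := by
      have := hbp L
      have := hN U
      have := hN (R z F)
      positivity
    calc N U ^ 2 = ((properSplits L).map fun p =>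
          -inner ℝ (C p.1 z (p.2.foldr partialD R z F)) U).sum := by
          have h1 := List.sum_map_mul_left (properSplits L)
            (fun p => inner ℝ (C p.1 z (p.2.foldr partialD R z F)) U) (-1 : ℝ)
          simp only [neg_one_mul] at h1
          linarith
      _ ≤ ((properSplits L).map fun p =>
          c * (p.2.length.factorial / Real.log 2 ^ p.2.length)).sum := List.sum_le_sum hbound
      _ = c * ∑ k ∈ Finset.range n, (n.choose k : ℝ) * (k.factorial / Real.log 2 ^ k) := by
          rw [List.sum_map_mul_left, sum_properSplits (fun k => k.factorial / Real.log 2 ^ k), hn]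
      _ ≤ _ := by
          gcongr
          exact sum_choose_mul_factorial_div_le n
  rcases (hN U).eq_or_lt with h | h
  · rw [← h]
    have h1 := hbp L
    have h2 := hN (R z F)
    have h3 : 0 < Real.log 2 := Real.log_pos (by norm_num)
    positivity
  · refine le_of_mul_le_mul_right ?_ h
    rw [← pow_two]
    refine hN2.trans (le_of_eq ?_)
    rw [hc]
    ring

end Word

/-! ### The solution operator -/

/-- The compression `T ↦ P T ι` of operators to a closed subspace, where `ι` is the inclusion and
`P` the orthogonal projection. -/
noncomputable def compression {E : Type*} [NormedAddCommGroup E] [InnerProductSpace ℝ E]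
    (K : Submodule ℝ E) [CompleteSpace K] : (E →L[ℝ] E) →L[ℝ] (K →L[ℝ] K) :=
  (ContinuousLinearMap.compL ℝ K E K K.orthogonalProjectionOnto).comp
    ((ContinuousLinearMap.compL ℝ K E E).flip K.subtypeL)

lemma inner_compression {E : Type*} [NormedAddCommGroup E] [InnerProductSpace ℝ E]
    (K : Submodule ℝ E) [CompleteSpace K] (T : E →L[ℝ] E) (p q : K) :
    inner ℝ (compression K T p) q = inner ℝ (T p) (q : E) :=
  Submodule.inner_orthogonalProjectionOnto_eq_of_mem_right q (T p)

lemma contDiff_clm_comp {X E F : Type*} [NormedAddCommGroup X] [NormedSpace ℝ X]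
    [NormedAddCommGroup E] [NormedSpace ℝ E] [NormedAddCommGroup F] [NormedSpace ℝ F]
    (Λ : E →L[ℝ] F) {f : X → E} (hf : ContDiff ℝ ∞ f) : ContDiff ℝ ∞ fun z => Λ (f z) :=
  Λ.contDiff.comp hf

lemma partialD_clm_comp {s : ℕ} {E F : Type*}
    [NormedAddCommGroup E] [NormedSpace ℝ E] [NormedAddCommGroup F] [NormedSpace ℝ F]
    (Λ : E →L[ℝ] F) {f : (Fin s → ℝ) → E} (hf : ContDiff ℝ ∞ f) (j : Fin s) (z : Fin s → ℝ) :
    partialD j (fun z => Λ (f z)) z = Λ (partialD j f z) := by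
  have h : fderiv ℝ (fun z => Λ (f z)) z = _ :=
    (Λ.hasFDerivAt.comp z (hf.differentiable (by simp) z).hasFDerivAt).fderiv
  rw [partialD, h]
  rfl

lemma contDiff_ringInverse_comp {X A : Type*} [NormedAddCommGroup X] [NormedSpace ℝ X]
    [NormedRing A] [NormedAlgebra ℝ A] [CompleteSpace A] {f : X → A} (hf : ContDiff ℝ ∞ f)
    (hu : ∀ z, IsUnit (f z)) : ContDiff ℝ ∞ fun z => Ring.inverse (f z) := by
  rw [contDiff_iff_contDiffAt]
  intro z
  obtain ⟨x, hx⟩ := hu z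
  have h := contDiffAt_ringInverse ℝ (n := ∞) x
  rw [hx] at h
  exact h.comp z hf.contDiffAt

section SolutionOp

variable {d s : ℕ} {D : Set (EuclideanSpace ℝ (Fin d))}
  (K : Submodule ℝ (Lp (EuclideanSpace ℝ (Fin d)) 2 (domMeasure D))) [CompleteSpace K]

/-- The operator on `K` of the bilinear form `(p, q) ↦ ∫ W p · q`, as a function of `W ∈ L^∞`. -/
noncomputable def compress : Lp ℝ ∞ (domMeasure D) →L[ℝ] (K →L[ℝ] K) :=
  (compression K).comp mulL

lemma inner_compress (W : Lp ℝ ∞ (domMeasure D)) (p q : K) :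
    inner ℝ (compress K W p) q =
      inner ℝ (mulL W (p : Lp (EuclideanSpace ℝ (Fin d)) 2 (domMeasure D)))
        (q : Lp (EuclideanSpace ℝ (Fin d)) 2 (domMeasure D)) :=
  inner_compression K (mulL W) p q

lemma isUnit_compress {W : Lp ℝ ∞ (domMeasure D)} {c : ℝ} (hc : 0 < c)
    (hW : ∀ᵐ x ∂(domMeasure D), c ≤ W x) : IsUnit (compress K W) := by
  refine ContinuousLinearMap.isUnit_of_forall_le_norm_inner_map _ (c := ⟨c, hc.le⟩) hc fun p => ?_
  rw [inner_compress, mul_comm]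
  exact (mul_norm_sq_le_inner_mulL hW (p : Lp (EuclideanSpace ℝ (Fin d)) 2 (domMeasure D))).trans
    (le_abs_self _)

/-- The solution operator `z ↦ A(z)⁻¹` of the parametric equation on the space `K` of gradients. -/
noncomputable def solutionOp (a : Fin s → Lp ℝ ∞ (domMeasure D)) (z : Fin s → ℝ) : K →L[ℝ] K :=
  Ring.inverse (compress K (weight a [] z))

variable {K} {a : Fin s → Lp ℝ ∞ (domMeasure D)}

lemma contDiff_compress_weight (S : List (Fin s)) :
    ContDiff ℝ ∞ fun z => compress K (weight a S z) :=
  contDiff_clm_comp (F := K →L[ℝ] K) (compress K) (contDiff_weight a S)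

lemma contDiff_solutionOp (hu : ∀ z, IsUnit (compress K (weight a [] z))) :
    ContDiff ℝ ∞ (solutionOp K a) :=
  contDiff_ringInverse_comp (A := K →L[ℝ] K) (contDiff_compress_weight []) hu

lemma partialD_compress_weight (j : Fin s) (S : List (Fin s)) :
    partialD j (fun z => compress K (weight a S z)) = fun z => compress K (weight a (j :: S) z) := by
  funext z
  refine (partialD_clm_comp (F := K →L[ℝ] K) (compress K) (contDiff_weight a S) j z).trans ?_
  rw [partialD, fderiv_weight_single]

/-- The bound on the derivatives of the solution with source `F`. -/
lemma norm_foldr_partialD_solutionOp_le (hu : ∀ z, IsUnit (compress K (weight a [] z)))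
    {z : Fin s → ℝ} {c : ℝ} (hc : 0 < c) (hW : ∀ᵐ x ∂(domMeasure D), c ≤ weight a [] z x)
    (F : K) (L : List (Fin s)) :
    ‖L.foldr partialD (solutionOp K a) z F‖ ≤
      (L.map fun j => ‖a j‖).prod * (L.length.factorial / Real.log 2 ^ L.length)
        * (‖F‖ / c) := by
  set N : K → ℝ := fun p => ‖mulL (weight a [] ((1 / 2 : ℝ) • z))
    (p : Lp (EuclideanSpace ℝ (Fin d)) 2 (domMeasure D))‖ with hN
  have hN0 : ∀ p, 0 ≤ N p := fun p => norm_nonneg _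
  have hCR : ∀ z, compress K (weight a [] z) * solutionOp K a z = 1 :=
    fun z => Ring.mul_inverse_cancel _ (hu z)
  have hNC : ∀ p : K, inner ℝ (compress K (weight a [] z) p) p = N p ^ 2 := fun p => by
    rw [inner_compress, inner_mulL_weight_nil_self]
  have key := energy_foldr_partialD_le (C := fun S z => compress K (weight a S z))
    (R := solutionOp K a) contDiff_compress_weight
    partialD_compress_weight (contDiff_solutionOp hu) hCR z (fun j => ‖a j‖)
    (fun j => norm_nonneg _) N hN0 hNC
    (fun S p q => by rw [inner_compress]; exact abs_inner_mulL_weight_le a S z p q) F L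
  have hsc : 0 < √c := Real.sqrt_pos.2 hc
  have hlow : ∀ p : K, √c * ‖p‖ ≤ N p := fun p => by
    have h1 := mul_norm_sq_le_inner_mulL hW
      (p : Lp (EuclideanSpace ℝ (Fin d)) 2 (domMeasure D))
    rw [inner_mulL_weight_nil_self] at h1
    refine (abs_le_of_sq_le_sq' ?_ (hN0 p)).2
    rw [mul_pow, Real.sq_sqrt hc.le]
    exact h1
  have hRF : √c * N (solutionOp K a z F) ≤ ‖F‖ := by
    set U := solutionOp K a z F with hU
    have h1 : N U ^ 2 ≤ ‖F‖ * ‖U‖ := by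
      rw [← hNC, hU]
      have h2 : compress K (weight a [] z) (solutionOp K a z F) = F :=
        congrArg (fun T : K →L[ℝ] K => T F) (hCR z)
      rw [h2]
      exact real_inner_le_norm _ _
    rcases (hN0 U).eq_or_lt with h | h
    · rw [← h, mul_zero]; exact norm_nonneg _
    · refine le_of_mul_le_mul_right ?_ h
      calc √c * N U * N U = √c * N U ^ 2 := by ring
        _ ≤ √c * (‖F‖ * ‖U‖) := by gcongr
        _ = ‖F‖ * (√c * ‖U‖) := by ring
        _ ≤ ‖F‖ * N U := by gcongr; exact hlow U
  have hb := prod_map_norm_nonneg a L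
  have hl : 0 < Real.log 2 := Real.log_pos (by norm_num)
  set V := L.foldr partialD (solutionOp K a) z F
  rw [← mul_div_assoc, le_div_iff₀ hc]
  calc ‖V‖ * c = √c * (√c * ‖V‖) := by
        rw [← mul_assoc, Real.mul_self_sqrt hc.le, mul_comm]
    _ ≤ √c * N V := by gcongr; exact hlow V
    _ ≤ √c * (_ * N (solutionOp K a z F)) := by gcongr
    _ = (L.map fun j => ‖a j‖).prod * (L.length.factorial / Real.log 2 ^ L.length)
        * (√c * N (solutionOp K a z F)) := by ring
    _ ≤ _ := by gcongr

end SolutionOp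

namespace H10

variable {d s : ℕ} {D : Set (EuclideanSpace ℝ (Fin d))}

/-- The Riesz representative of `F ∈ V*` in the space of gradients. -/
lemma exists_riesz (hd : 0 < d) (hDb : Bornology.IsBounded D) (F : Hneg1 D) :
    ∃ f : LinearMap.range (grad (D := D)), ‖f‖ ≤ ‖F‖ ∧
      ∀ v : H10 D, inner ℝ (f : Lp (EuclideanSpace ℝ (Fin d)) 2 (domMeasure D)) (grad v) = F v := by
  have : CompleteSpace (LinearMap.range (grad (D := D))) :=
    (isClosed_range_grad hd hDb).completeSpace_coe
  let e := LinearEquiv.ofInjective (grad (D := D)) (grad_injective hd hDb)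
  have he : ∀ v, e v = (⟨grad v, v, rfl⟩ : LinearMap.range (grad (D := D))) := fun v => rfl
  let Λ : StrongDual ℝ (LinearMap.range (grad (D := D))) :=
    LinearMap.mkContinuous ((F : H10 D →ₗ[ℝ] ℝ).comp e.symm.toLinearMap) ‖F‖ fun p => by
      obtain ⟨v, rfl⟩ := e.surjective p
      have h := F.le_opNorm v
      rw [norm_eq_norm_grad] at h
      change |F (e.symm (e v))| ≤ _
      rw [e.symm_apply_apply]
      exact h
  refine ⟨(InnerProductSpace.toDual ℝ _).symm Λ, ?_, fun v => ?_⟩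
  · rw [LinearIsometryEquiv.norm_map]
    exact LinearMap.mkContinuous_norm_le _ (norm_nonneg _) _
  · have h := InnerProductSpace.toDual_symm_apply (𝕜 := ℝ) (x := e v) (y := Λ)
    have h2 : Λ (e v) = F v := by simp [Λ]
    rw [h2, he] at h
    exact h

lemma weakForm_eq_inner (a : Fin s → Lp ℝ ∞ (domMeasure D)) (z : Fin s → ℝ) (u v : H10 D) :
    ∫ x, coeff a z x * inner ℝ (grad u x) (grad v x) ∂(domMeasure D) =
      inner ℝ (mulL (weight a [] z) (grad u)) (grad v) := by
  rw [inner_mulL]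
  refine integral_congr_ae ((coeFn_weight_nil a z).mono fun x hx => ?_)
  simp only [hx]

/-- The gradient of a weak solution is given by the solution operator. -/
lemma grad_eq_solutionOp [CompleteSpace (LinearMap.range (grad (D := D)))]
    {a : Fin s → Lp ℝ ∞ (domMeasure D)}
    {z : Fin s → ℝ} (hu : IsUnit (compress (LinearMap.range (grad (D := D))) (weight a [] z)))
    {F : Hneg1 D} {u : H10 D} (hsol : IsWeakSolution a z F u)
    {f : LinearMap.range (grad (D := D))}
    (hf : ∀ v : H10 D,
      inner ℝ (f : Lp (EuclideanSpace ℝ (Fin d)) 2 (domMeasure D)) (grad v) = F v) :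
    (⟨grad u, u, rfl⟩ : LinearMap.range (grad (D := D))) = solutionOp _ a z f := by
  have h1 : compress (LinearMap.range (grad (D := D))) (weight a [] z) ⟨grad u, u, rfl⟩ = f := by
    refine ext_inner_right ℝ fun q => ?_
    obtain ⟨_, v, rfl⟩ := q
    rw [inner_compress]
    refine Eq.trans ?_ (hf v).symm
    rw [← hsol v, weakForm_eq_inner]
  rw [← h1, solutionOp]
  exact (congrArg (fun T : LinearMap.range (grad (D := D)) →L[ℝ] _ => T ⟨grad u, u, rfl⟩)
    (Ring.inverse_mul_cancel _ hu)).symm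

/-- `G(u₀) = ℓ₀(p) = ∫ l₀ p`, where `p` is the solution of the (self-adjoint) equation with source
`G`, which is nonnegative by the maximum principle and does not vanish. -/
theorem functional_solution_pos (hd : 0 < d) (hDb : Bornology.IsBounded D)
    {a : Fin s → Lp ℝ ∞ (domMeasure D)} {z : Fin s → ℝ} {c : ℝ} (hc : 0 < c)
    (ha : ∀ᵐ x ∂(domMeasure D), c ≤ coeff a z x) {l : Hneg1 D} {l₀ : Lp ℝ ∞ (domMeasure D)}
    (hl₀ : ∀ v : H10 D, l v = ∫ x, l₀ x * val v x ∂(domMeasure D))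
    (hl₀_pos : ∃ c > 0, ∀ᵐ x ∂(domMeasure D), c ≤ l₀ x)
    {G : Hneg1 D} (hG_pos : IsPositiveFunctional G) (hG_ne : G ≠ 0) {u₀ : H10 D}
    (hu₀ : IsWeakSolution a z l u₀) : 0 < G u₀ := by
  have : CompleteSpace (LinearMap.range (grad (D := D))) :=
    (isClosed_range_grad hd hDb).completeSpace_coe
  have hW : ∀ᵐ x ∂(domMeasure D), c ≤ weight a [] z x := by
    filter_upwards [ha, coeFn_weight_nil a z] with x h1 h2
    rwa [h2]
  have hunit := isUnit_compress (LinearMap.range (grad (D := D))) hc hW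
  obtain ⟨g, -, hg⟩ := exists_riesz hd hDb G
  obtain ⟨p, hp⟩ := (solutionOp _ a z g).2
  have hpG : ∀ v : H10 D, inner ℝ (mulL (weight a [] z) (grad p)) (grad v) = G v := by
    intro v
    rw [← hg v, hp, ← inner_compress (LinearMap.range (grad (D := D))) (weight a [] z)
      (solutionOp _ a z g) ⟨grad v, v, rfl⟩]
    have h2 : compress (LinearMap.range (grad (D := D))) (weight a [] z)
        (solutionOp _ a z g) = g :=
      congrArg (fun T : LinearMap.range (grad (D := D)) →L[ℝ] LinearMap.range (grad (D := D)) =>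
        T g) (Ring.mul_inverse_cancel _ hunit)
    rw [h2]
    rfl
  have hp0 := val_nonneg_of_isPositiveFunctional hd hDb hc hW hG_pos hpG
  obtain ⟨c', hc', hl⟩ := hl₀_pos
  have hGu : G u₀ = ∫ x, l₀ x * val p x ∂(domMeasure D) := by
    rw [← hpG, inner_mulL_comm, ← weakForm_eq_inner, hu₀ p, hl₀]
  have hnn : 0 ≤ᵐ[domMeasure D] fun x => l₀ x * val p x := by
    filter_upwards [hp0, hl] with x h1 h2
    exact mul_nonneg (hc'.le.trans h2) h1
  have hfin : IsFiniteMeasure (domMeasure D) := by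
    refine ⟨?_⟩
    rw [Measure.restrict_apply_univ]
    exact hDb.measure_lt_top
  have hint : Integrable (fun x => l₀ x * val p x) (domMeasure D) :=
    ((Lp.memLp (val p)).integrable one_le_two).bdd_mul (Lp.aestronglyMeasurable l₀)
      (ae_norm_le_norm_Lp_top l₀)
  rw [hGu]
  refine (integral_nonneg_of_ae hnn).lt_of_ne fun h0 => hG_ne ?_
  have hval : ∀ᵐ x ∂(domMeasure D), val p x = 0 := by
    filter_upwards [(integral_eq_zero_iff_of_nonneg_ae hnn hint).1 h0.symm, hl] with x h1 h2
    exact (mul_eq_zero.1 h1).resolve_left (hc'.trans_le h2).ne'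
  -- `p` and `-p` are both nonnegative, so that `G p = 0` is the energy of `p`.
  have h1 : 0 ≤ G p := hG_pos p hp0
  have h2 : 0 ≤ G (-p) := by
    refine hG_pos _ ?_
    rw [map_neg]
    filter_upwards [hval, Lp.coeFn_neg (val p)] with x h1 h2
    rw [h2, Pi.neg_apply, h1, neg_zero]
  have h3 : G p = 0 := le_antisymm (by rw [map_neg] at h2; linarith) h1
  have h4 : ‖grad p‖ ^ 2 ≤ 0 := by
    have := mul_norm_sq_le_inner_mulL hW (grad p)
    rw [hpG, h3] at this
    nlinarith
  have h5 : grad p = 0 := by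
    rw [← norm_eq_zero]
    exact pow_eq_zero_iff two_ne_zero |>.1 (le_antisymm h4 (by positivity))
  ext v
  rw [← hpG v, h5, map_zero, inner_zero_left]
  rfl

end H10

/-! ### Mixed derivatives of the quantity of interest -/

section Qoi

variable {s : ℕ} {H : Type*} [NormedAddCommGroup H] [InnerProductSpace ℝ H]

/-- The source as a function of `(w₀, …, w_s)`. -/
def affineSource (fbar : H) (f : Fin (s + 1) → H) (y : FullIdx s → ℝ) : H :=
  fbar + ∑ i, y (Sum.inl i) • f i

/-- The functional `g` of the solution with affine source, for the solution operator `T(z)`. -/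
noncomputable def qoi (g fbar : H) (f : Fin (s + 1) → H) (T : (Fin s → ℝ) → H →L[ℝ] H)
    (y : FullIdx s → ℝ) : ℝ :=
  inner ℝ g (T (fun j => y (Sum.inr j)) (affineSource fbar f y))

lemma affineSource_fullParam (fbar : H) (f : Fin (s + 1) → H) (w z : Fin s → ℝ) (y₀ : ℝ) :
    affineSource fbar f (fullParam y₀ w z) = fbar + ∑ i : Fin s, w i • f i.succ + y₀ • f 0 := by
  simp only [affineSource, fullParam, Sum.elim_inl, Fin.sum_univ_succ, Fin.cons_zero,
    Fin.cons_succ]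
  abel

lemma qoi_fullParam (g fbar : H) (f : Fin (s + 1) → H) (T : (Fin s → ℝ) → H →L[ℝ] H) (y₀ : ℝ)
    (w z : Fin s → ℝ) : qoi g fbar f T (fullParam y₀ w z) =
      inner ℝ g (T z (fbar + ∑ i : Fin s, w i • f i.succ)) + y₀ * inner ℝ g (T z (f 0)) := by
  rw [qoi, affineSource_fullParam, map_add, map_smul, inner_add_right, real_inner_smul_right]
  rfl

lemma pderivAt_inr_qoi (g fbar : H) (f : Fin (s + 1) → H) {T : (Fin s → ℝ) → H →L[ℝ] H}
    (hT : ContDiff ℝ ∞ T) (j : Fin s) :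
    pderivAt (Sum.inr j) (qoi g fbar f T) = qoi g fbar f (partialD j T) := by
  funext y
  rw [pderivAt, lineDeriv]
  have h1 : HasDerivAt (fun t : ℝ => T ((fun j => y (Sum.inr j)) + t • Pi.single j 1))
      (partialD j T fun j => y (Sum.inr j)) 0 :=
    (hT.differentiable (by simp) _).hasFDerivAt.hasLineDerivAt _
  have h2 : HasDerivAt (fun t : ℝ => inner ℝ g
      (T ((fun j => y (Sum.inr j)) + t • Pi.single j 1) (affineSource fbar f y)))
      (inner ℝ g (partialD j T (fun j => y (Sum.inr j)) (affineSource fbar f y))) 0 :=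
    (innerSL ℝ g).hasFDerivAt.comp_hasDerivAt 0
      ((ContinuousLinearMap.apply ℝ H (affineSource fbar f y)).hasFDerivAt.comp_hasDerivAt 0 h1)
  rw [qoi, ← h2.deriv]
  congr 1
  funext t
  rw [qoi]
  have e1 : (fun i => (y + t • Pi.single (Sum.inr j) 1 : FullIdx s → ℝ) (Sum.inr i)) =
      (fun j => y (Sum.inr j)) + t • Pi.single j 1 := by
    funext i
    simp [Pi.single_apply]
  have e2 : affineSource fbar f (y + t • Pi.single (Sum.inr j) 1) = affineSource fbar f y := by
    simp [affineSource]
  rw [e1, e2]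

lemma pderivAt_inl_qoi (g fbar : H) (f : Fin (s + 1) → H) (T : (Fin s → ℝ) → H →L[ℝ] H)
    (i : Fin (s + 1)) :
    pderivAt (Sum.inl i) (qoi g fbar f T) =
      fun y => inner ℝ g (T (fun j => y (Sum.inr j)) (f i)) := by
  funext y
  rw [pderivAt, lineDeriv]
  set z : Fin s → ℝ := fun j => y (Sum.inr j) with hz
  have e : (fun t : ℝ => qoi g fbar f T (y + t • Pi.single (Sum.inl i) 1)) =
      fun t => qoi g fbar f T y + t * inner ℝ g (T z (f i)) := by
    funext t
    have e1 : (fun j => (y + t • Pi.single (Sum.inl i) 1 : FullIdx s → ℝ) (Sum.inr j)) = z := by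
      funext j
      simp [hz]
    have e2 : affineSource fbar f (y + t • Pi.single (Sum.inl i) 1) =
        affineSource fbar f y + t • f i := by
      simp [affineSource, add_smul, Finset.sum_add_distrib, add_assoc, Pi.single_apply]
    rw [qoi, qoi, e1, e2, map_add, map_smul, inner_add_right, real_inner_smul_right]
  have h := (((hasDerivAt_id (0 : ℝ)).mul_const (inner ℝ g (T z (f i)))).const_add
    (qoi g fbar f T y)).deriv
  rw [one_mul] at h
  rw [e]
  exact h

lemma pderivAt_inl_of_inr (ψ : (Fin s → ℝ) → ℝ) (i : Fin (s + 1)) :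
    pderivAt (Sum.inl i) (fun y : FullIdx s → ℝ => ψ fun j => y (Sum.inr j)) = fun _ => 0 := by
  funext y
  rw [pderivAt, lineDeriv]
  simp

lemma foldr_pderivAt_inr_qoi (g fbar : H) (f : Fin (s + 1) → H) {T : (Fin s → ℝ) → H →L[ℝ] H}
    (hT : ContDiff ℝ ∞ T) (L : List (Fin s)) :
    L.foldr (fun j => pderivAt (Sum.inr j)) (qoi g fbar f T) =
      qoi g fbar f (L.foldr partialD T) := by
  induction L with
  | nil => rfl
  | cons j L ih => rw [List.foldr_cons, ih, pderivAt_inr_qoi _ _ _ (contDiff_foldr_partialD L hT),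
      List.foldr_cons]

/-- The derivatives in the variables `w` of a functional of the solution, which is affine in `w`:
at a word of length at least two they vanish. -/
lemma abs_foldr_pderivAt_inl_qoi_le (g fbar : H) (f : Fin (s + 1) → H)
    (T : (Fin s → ℝ) → H →L[ℝ] H) (L : List (Fin (s + 1))) (y : FullIdx s → ℝ)
    {B : ℝ} {c : Fin (s + 1) → ℝ} (hc : ∀ i, 0 ≤ c i) (hB : 0 ≤ B)
    (h0 : |qoi g fbar f T y| ≤ B)
    (h1 : ∀ i, |inner ℝ g (T (fun j => y (Sum.inr j)) (f i))| ≤ B * c i) :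
    |L.foldr (fun i => pderivAt (Sum.inl i)) (qoi g fbar f T) y| ≤ B * (L.map c).prod := by
  have hp : ∀ S : List (Fin (s + 1)), 0 ≤ (S.map c).prod := fun S => List.prod_nonneg fun x hx => by
    obtain ⟨j, -, rfl⟩ := List.mem_map.1 hx
    exact hc j
  rcases List.eq_nil_or_concat' L with rfl | ⟨L, i, rfl⟩
  · simpa using h0
  · rw [List.foldr_append, List.foldr_cons, List.foldr_nil, pderivAt_inl_qoi]
    rcases List.eq_nil_or_concat' L with rfl | ⟨L, i', rfl⟩
    · simpa using h1 i
    · rw [List.foldr_append, List.foldr_cons, List.foldr_nil,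
        pderivAt_inl_of_inr (fun z => inner ℝ g (T z (f i)))]
      have hz : L.foldr (fun i => pderivAt (Sum.inl i)) (fun _ : FullIdx s → ℝ => (0 : ℝ)) =
          fun _ => 0 := by
        induction L with
        | nil => rfl
        | cons k L ih => rw [List.foldr_cons, ih, pderivAt_inl_of_inr fun _ => (0 : ℝ)]
      rw [hz, abs_zero]
      exact mul_nonneg hB (hp _)

end Qoi

/-! ### The bound on the chain-rule terms -/

/-- With `γ = ‖G‖ / a_min`, the number `Q = c₀ γ X / φ₀²` is at least one, and `Q φ₀` bounds the
norms `γ ‖F‖` for the sources `F` that occur: `ℓ₀`, the normalised `ℓ_i`, and the source at `ξ`. -/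
lemma exists_common_bound {γ c₀ L T φ₀ ξ : ℝ} (hγ : 0 ≤ γ) (hc₀ : 0 ≤ c₀) (hL : 0 ≤ L) (hT : 0 ≤ T)
    (hφ₀ : 0 < φ₀) (hφ : φ₀ ≤ γ * c₀) (hξ : |ξ| * φ₀ ≤ T + γ * L) :
    1 ≤ c₀ * γ * (T + 2 * γ * (L + c₀ + 1)) / φ₀ ^ 2 ∧
    γ * c₀ ≤ c₀ * γ * (T + 2 * γ * (L + c₀ + 1)) / φ₀ ^ 2 * φ₀ ∧
    γ ≤ c₀ * γ * (T + 2 * γ * (L + c₀ + 1)) / φ₀ ^ 2 * φ₀ ∧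
    γ * (L + c₀ * |ξ|) ≤ c₀ * γ * (T + 2 * γ * (L + c₀ + 1)) / φ₀ ^ 2 * φ₀ := by
  set X := T + 2 * γ * (L + c₀ + 1) with hX
  have e : c₀ * γ * X / φ₀ ^ 2 * φ₀ = c₀ * γ * X / φ₀ := by
    field_simp
  have hγL : 0 ≤ γ * L := by positivity
  have hγc : 0 ≤ γ * c₀ := by positivity
  have hXφ : φ₀ ≤ X := by nlinarith
  have hcX : φ₀ ≤ c₀ * X := by
    have : 0 ≤ c₀ * (T + 2 * (γ * L) + 2 * (γ * c₀)) := by positivity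
    nlinarith
  rw [e]
  refine ⟨?_, ?_, ?_, ?_⟩
  · rw [one_le_div (by positivity), pow_two]
    exact mul_le_mul (by linarith) hXφ hφ₀.le (by linarith)
  · rw [le_div_iff₀ hφ₀, mul_comm γ]
    gcongr
  · rw [le_div_iff₀ hφ₀]
    calc γ * φ₀ ≤ γ * (c₀ * X) := by gcongr
      _ = _ := by ring
  · rw [le_div_iff₀ hφ₀]
    have h1 : L * φ₀ ≤ L * (γ * c₀) := by gcongr
    have h2 : c₀ * (|ξ| * φ₀) ≤ c₀ * (T + γ * L) := by gcongr
    have h3 : (L + c₀ * |ξ|) * φ₀ ≤ c₀ * X := by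
      have : 0 ≤ c₀ * (γ * (c₀ + 1)) := by positivity
      rw [hX]
      nlinarith
    calc γ * (L + c₀ * |ξ|) * φ₀ = γ * ((L + c₀ * |ξ|) * φ₀) := by ring
      _ ≤ γ * (c₀ * X) := by gcongr
      _ = _ := by ring

lemma prod_factorial_div_le {r : ℕ} (n : Fin r → ℕ) {m : ℕ} (h : ∑ k, n k ≤ m) :
    ∏ k, ((n k).factorial / Real.log 2 ^ n k : ℝ) ≤ m.factorial / Real.log 2 ^ m := by
  have hl : 0 < Real.log 2 := Real.log_pos (by norm_num)
  have hl1 : Real.log 2 ≤ 1 := by linarith [Real.log_two_lt_d9]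
  rw [Finset.prod_div_distrib, Finset.prod_pow_eq_pow_sum]
  refine div_le_div₀ (by positivity) ?_ (by positivity) (pow_le_pow_of_le_one hl.le hl1 h)
  rw [← Nat.cast_prod]
  exact_mod_cast (Nat.le_of_dvd (Nat.factorial_pos _)
    (Nat.prod_factorial_dvd_factorial_sum Finset.univ n)).trans (Nat.factorial_le h)

/-- The estimate of the term, given a common bound `Q` of its factors relative to `φ₀`. -/
lemma abs_hTerm_le_of_factors {s : ℕ} {φ : (FullIdx s → ℝ) → ℝ} {q r : ℕ} {η : RedIdx s → ℕ}
    {α : Fin r → FullIdx s → ℕ} {β : ℕ} (hadm : IsAdmissible q η r α β) (t : ℝ) (w z : Fin s → ℝ)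
    {Q φ₀ : ℝ} (b c : Fin s → ℝ) (hb : ∀ j, 0 ≤ b j) (hc : ∀ i, 0 ≤ c i) (hφ₀ : 0 < φ₀)
    (hQ : 1 ≤ Q)
    (hden : pderivAt (Sum.inl 0) φ (fullParam (xiPoint φ t w z) w z) = φ₀)
    (hfac : ∀ k, |mixedDeriv (α k) φ (fullParam (xiPoint φ t w z) w z)| ≤
      Q * φ₀ * (∏ i, c i ^ α k (Sum.inl i.succ)) * (∏ j, b j ^ α k (Sum.inr j)) *
        ((∑ j, α k (Sum.inr j)).factorial / Real.log 2 ^ ∑ j, α k (Sum.inr j))) :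
    |hTerm φ q r α β t w z| ≤
      1 / √(2 * Real.pi)
        * (((order η).factorial * √((order η + q - 1).factorial : ℝ)) / Real.log 2 ^ order η)
        * (∏ j : Fin s, b j ^ η (Sum.inr j))
        * (∏ i : Fin s, c i ^ η (Sum.inl i))
        * (Q ^ (2 * order η + q - 1) / φ₀ ^ q) := by
  have hl : 0 < Real.log 2 := Real.log_pos (by norm_num)
  have hQ0 : 0 ≤ Q := zero_le_one.trans hQ
  have hrho : |iteratedDeriv β (gaussianPDFReal 0 1) (xiPoint φ t w z)| ≤
      1 / √(2 * Real.pi) * √((order η + q - 1).factorial : ℝ) := by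
    refine (abs_iteratedDeriv_gaussianPDFReal_le β _).trans ?_
    -- the subtraction is genuine, since `0 ≤ β ≤ |η| + q - 1` in `ℤ`
    have hβ : β ≤ order η + q - 1 := by have := hadm.β_le; omega
    gcongr
  have hprod : |∏ k, mixedDeriv (α k) φ (fullParam (xiPoint φ t w z) w z)| ≤
      (Q * φ₀) ^ r * (∏ i, c i ^ η (Sum.inl i)) * (∏ j, b j ^ η (Sum.inr j))
        * ((order η).factorial / Real.log 2 ^ order η) := by
    rw [Finset.abs_prod]
    refine (Finset.prod_le_prod (fun k _ => abs_nonneg _) fun k _ => hfac k).trans ?_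
    rw [Finset.prod_mul_distrib, Finset.prod_mul_distrib, Finset.prod_mul_distrib,
      Finset.prod_const, Finset.card_univ, Fintype.card_fin, Finset.prod_comm,
      Finset.prod_comm (f := fun k j => b j ^ α k (Sum.inr j))]
    simp only [Finset.prod_pow_eq_pow_sum, hadm.sum_w, hadm.sum_z]
    have h1 : 0 ≤ ∏ i, c i ^ η (Sum.inl i) := Finset.prod_nonneg fun i _ => pow_nonneg (hc i) _
    have h2 : 0 ≤ ∏ j, b j ^ η (Sum.inr j) := Finset.prod_nonneg fun j _ => pow_nonneg (hb j) _
    gcongr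
    refine prod_factorial_div_le (fun k => ∑ j, α k (Sum.inr j)) ?_
    rw [Finset.sum_comm]
    simp only [hadm.sum_z]
    rw [order, Fintype.sum_sum_type]
    exact Nat.le_add_left _ _
  have hr : r ≤ 2 * order η + q - 1 := by have := hadm.r_le; omega
  have h1 : 0 ≤ ∏ i, c i ^ η (Sum.inl i) := Finset.prod_nonneg fun i _ => pow_nonneg (hc i) _
  have h2 : 0 ≤ ∏ j, b j ^ η (Sum.inr j) := Finset.prod_nonneg fun j _ => pow_nonneg (hb j) _
  rw [hTerm, hden, abs_div, abs_mul, abs_mul, abs_pow, abs_neg, abs_one, one_pow, one_mul,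
    abs_of_pos (pow_pos hφ₀ (r + q))]
  calc _ ≤ (1 / √(2 * Real.pi) * √((order η + q - 1).factorial : ℝ)) *
        ((Q * φ₀) ^ r * (∏ i, c i ^ η (Sum.inl i)) * (∏ j, b j ^ η (Sum.inr j))
        * ((order η).factorial / Real.log 2 ^ order η)) / φ₀ ^ (r + q) := by gcongr
    _ = 1 / √(2 * Real.pi)
        * (((order η).factorial * √((order η + q - 1).factorial : ℝ)) / Real.log 2 ^ order η)
        * (∏ j : Fin s, b j ^ η (Sum.inr j))
        * (∏ i : Fin s, c i ^ η (Sum.inl i)) * (Q ^ r / φ₀ ^ q) := by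
        rw [mul_pow, pow_add]
        field_simp
    _ ≤ _ := by gcongr

/-- The bound on a mixed derivative of `y ↦ G(u(y))`, for `γ = ‖G‖ / c` and `B` a common bound of
`γ ‖F‖` for the sources `F` that occur. -/
lemma abs_mixedDeriv_qoi_le {d s : ℕ} {D : Set (EuclideanSpace ℝ (Fin d))}
    {K : Submodule ℝ (Lp (EuclideanSpace ℝ (Fin d)) 2 (domMeasure D))} [CompleteSpace K]
    {a : Fin s → Lp ℝ ∞ (domMeasure D)} (hu : ∀ z, IsUnit (compress K (weight a [] z)))
    (g fbar : K) (f : Fin (s + 1) → K) (y : FullIdx s → ℝ) {c : ℝ} (hc : 0 < c)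
    (hW : ∀ᵐ x ∂(domMeasure D), c ≤ weight a [] (fun j => y (Sum.inr j)) x)
    {B : ℝ} {κ : Fin s → ℝ} (hκ : ∀ i, 0 ≤ κ i)
    (hB : ‖g‖ * (‖affineSource fbar f y‖ / c) ≤ B) (hB0 : ‖g‖ * (‖f 0‖ / c) ≤ B)
    (hBi : ∀ i : Fin s, ‖g‖ * (‖f i.succ‖ / c) ≤ B * κ i) (α : FullIdx s → ℕ) :
    |mixedDeriv α (qoi g fbar f (solutionOp K a)) y| ≤
      B * (∏ i, κ i ^ α (Sum.inl i.succ)) * (∏ j, ‖a j‖ ^ α (Sum.inr j)) *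
        ((∑ j, α (Sum.inr j)).factorial / Real.log 2 ^ ∑ j, α (Sum.inr j)) := by
  set Lw := multiWord fun i => α (Sum.inl i)
  set Lz := multiWord fun j => α (Sum.inr j) with hLz
  have hl : 0 < Real.log 2 := Real.log_pos (by norm_num)
  set E : ℝ := (Lz.map fun j => ‖a j‖).prod * (Lz.length.factorial / Real.log 2 ^ Lz.length)
    with hE
  have hE0 : 0 ≤ E := mul_nonneg (prod_map_norm_nonneg a Lz) (by positivity)
  have hB' : 0 ≤ B := le_trans (by positivity) hB
  have hF : ∀ F : K, |inner ℝ g (Lz.foldr partialD (solutionOp K a)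
      (fun j => y (Sum.inr j)) F)| ≤ ‖g‖ * (‖F‖ / c) * E := by
    intro F
    refine (abs_real_inner_le_norm _ _).trans ?_
    rw [mul_assoc]
    gcongr
    refine (norm_foldr_partialD_solutionOp_le hu hc hW F Lz).trans (le_of_eq ?_)
    rw [hE]
    ring
  have h := abs_foldr_pderivAt_inl_qoi_le g fbar f (Lz.foldr partialD (solutionOp K a)) Lw y
    (B := B * E) (c := Fin.cons 1 κ)
    (fun i => Fin.cases (by simp) (fun i => by simpa using hκ i) i) (by positivity)
    ((hF _).trans (by gcongr)) fun i => (hF (f i)).trans (by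
      refine Fin.cases ?_ (fun i => ?_) i
      · rw [Fin.cons_zero, mul_one]
        gcongr
      · rw [Fin.cons_succ, mul_right_comm B]
        exact mul_le_mul_of_nonneg_right (hBi i) hE0)
  rw [mixedDeriv_eq_foldr, foldr_pderivAt_inr_qoi _ _ _ (contDiff_solutionOp hu)]
  refine h.trans (le_of_eq ?_)
  rw [hE, prod_map_multiWord, hLz, prod_map_multiWord, length_multiWord, Fin.prod_univ_succ]
  simp only [Fin.cons_zero, Fin.cons_succ, one_pow, one_mul]
  ring

/-- The estimate for the functional `y ↦ ⟨g, A(z)⁻¹ f(w)⟩` of the solution, where the numbers `G`,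
`Lb` and `ℓ i` bound the norms of `g`, of the constant part and of the components of the source. -/
theorem abs_hTerm_qoi_le {d s : ℕ} {D : Set (EuclideanSpace ℝ (Fin d))}
    {K : Submodule ℝ (Lp (EuclideanSpace ℝ (Fin d)) 2 (domMeasure D))} [CompleteSpace K]
    {a : Fin s → Lp ℝ ∞ (domMeasure D)} (hunit : ∀ z, IsUnit (compress K (weight a [] z)))
    {g fbar : K} {f : Fin (s + 1) → K} {G Lb : ℝ} {ℓ : Fin (s + 1) → ℝ}
    (hgn : ‖g‖ ≤ G) (hfbarn : ‖fbar‖ ≤ Lb) (hfn : ∀ i, ‖f i‖ ≤ ℓ i)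
    {q : ℕ} {η : RedIdx s → ℕ} {r : ℕ} {α : Fin r → FullIdx s → ℕ} {β : ℕ}
    (hadm : IsAdmissible q η r α β) (t : ℝ) (w z : Fin s → ℝ) {A : ℝ} (hA : 0 < A)
    (hW : ∀ᵐ x ∂(domMeasure D), A ≤ weight a [] z x) {φ₀ : ℝ} (hpos : 0 < φ₀)
    (hφ₀ : φ₀ = inner ℝ g (solutionOp K a z (f 0))) :
    |hTerm (qoi g fbar f (solutionOp K a)) q r α β t w z| ≤
      1 / √(2 * Real.pi)
        * (((order η).factorial * √((order η + q - 1).factorial : ℝ)) / Real.log 2 ^ order η)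
        * (∏ j : Fin s, ‖a j‖ ^ η (Sum.inr j))
        * (∏ i : Fin s, ℓ i.succ ^ η (Sum.inl i))
        * (1 / φ₀ ^ (4 * order η + 3 * q - 2))
        * (ℓ 0 * G / A * (|t| + 2 * G / A * (Lb + ℓ 0 + 1 + ∑ i : Fin s, ℓ i.succ * |w i|)))
          ^ (2 * order η + q - 1) := by
  have hG0 : 0 ≤ G := (norm_nonneg g).trans hgn
  have hLb0 : 0 ≤ Lb := (norm_nonneg fbar).trans hfbarn
  have hℓ : ∀ i, 0 ≤ ℓ i := fun i => (norm_nonneg (f i)).trans (hfn i)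
  obtain ⟨γ, hγ⟩ : ∃ γ, γ = G / A := ⟨_, rfl⟩
  have hγ0 : 0 ≤ γ := by rw [hγ]; positivity
  have hbound : ∀ F : K, |inner ℝ g (solutionOp K a z F)| ≤ γ * ‖F‖ := by
    intro F
    have h := norm_foldr_partialD_solutionOp_le hunit hA hW F []
    simp only [List.foldr_nil, List.map_nil, List.prod_nil, List.length_nil, Nat.factorial_zero,
      Nat.cast_one, pow_zero, div_one, one_mul] at h
    calc _ ≤ ‖g‖ * ‖solutionOp K a z F‖ := abs_real_inner_le_norm _ _
      _ ≤ G * (‖F‖ / A) := by gcongr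
      _ = _ := by rw [hγ]; ring
  obtain ⟨L, hL⟩ : ∃ L, L = Lb + ∑ i : Fin s, ℓ i.succ * |w i| := ⟨_, rfl⟩
  have hL0 : 0 ≤ L := hL ▸
    add_nonneg hLb0 (Finset.sum_nonneg fun i _ => mul_nonneg (hℓ _) (abs_nonneg _))
  -- the source with `w₀ = 0`
  set F₀ : K := fbar + ∑ i : Fin s, w i • f i.succ with hF₀
  have hF₀n : ‖F₀‖ ≤ L := by
    rw [hL]
    refine (norm_add_le _ _).trans (add_le_add hfbarn ?_)
    refine (norm_sum_le _ _).trans (Finset.sum_le_sum fun i _ => ?_)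
    rw [norm_smul, mul_comm, Real.norm_eq_abs]
    gcongr
    exact hfn _
  have haff : ∀ y₀ : ℝ, affineSource fbar f (fullParam y₀ w z) = F₀ + y₀ • f 0 :=
    affineSource_fullParam fbar f w z
  have hval : ∀ y₀ : ℝ, qoi g fbar f (solutionOp K a) (fullParam y₀ w z) =
      inner ℝ g (solutionOp K a z F₀) + y₀ * φ₀ := by
    intro y₀
    rw [hφ₀]
    exact qoi_fullParam g fbar f (solutionOp K a) y₀ w z
  set ξ := xiPoint (qoi g fbar f (solutionOp K a)) t w z with hξ
  have hξt : qoi g fbar f (solutionOp K a) (fullParam ξ w z) = t := by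
    refine Classical.epsilon_spec (p := fun y₀ : ℝ =>
      qoi g fbar f (solutionOp K a) (fullParam y₀ w z) = t)
      ⟨(t - inner ℝ g (solutionOp K a z F₀)) / φ₀, ?_⟩
    rw [hval, div_mul_cancel₀ _ hpos.ne']
    ring
  have hξle : |ξ| * φ₀ ≤ |t| + γ * L := by
    rw [hval] at hξt
    rw [show |ξ| * φ₀ = |ξ * φ₀| by rw [abs_mul, abs_of_pos hpos],
      show ξ * φ₀ = t - inner ℝ g (solutionOp K a z F₀) by linarith]
    refine (abs_sub _ _).trans (add_le_add le_rfl ((hbound F₀).trans ?_))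
    gcongr
  have hφ₀le : φ₀ ≤ γ * ℓ 0 := by
    rw [hφ₀]
    refine (le_abs_self _).trans ((hbound _).trans ?_)
    gcongr
    exact hfn 0
  obtain ⟨hQ1, hQ2, hQ3, hQ4⟩ := exists_common_bound hγ0 (hℓ 0) hL0 (abs_nonneg t)
    hpos hφ₀le hξle
  obtain ⟨X, hX⟩ : ∃ X, X = |t| + 2 * γ * (L + ℓ 0 + 1) := ⟨_, rfl⟩
  rw [← hX] at hQ1 hQ2 hQ3 hQ4
  obtain ⟨Q, hQ⟩ : ∃ Q, Q = ℓ 0 * γ * X / φ₀ ^ 2 := ⟨_, rfl⟩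
  rw [← hQ] at hQ1 hQ2 hQ3 hQ4
  have hsrc : ∀ {F : K} {M : ℝ}, ‖F‖ ≤ M → ‖g‖ * (‖F‖ / A) ≤ γ * M := by
    intro F M hF
    calc ‖g‖ * (‖F‖ / A) ≤ G * (M / A) := by gcongr
      _ = γ * M := by rw [hγ]; ring
  have hsξ : ‖g‖ * (‖affineSource fbar f (fullParam ξ w z)‖ / A) ≤ Q * φ₀ := by
    refine (hsrc (M := L + ℓ 0 * |ξ|) ?_).trans hQ4
    rw [haff]
    refine (norm_add_le _ _).trans (add_le_add hF₀n ?_)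
    rw [norm_smul, mul_comm, Real.norm_eq_abs]
    exact mul_le_mul_of_nonneg_right (hfn 0) (abs_nonneg ξ)
  have hs0 : ‖g‖ * (‖f 0‖ / A) ≤ Q * φ₀ := (hsrc (hfn 0)).trans hQ2
  have hsi : ∀ i : Fin s, ‖g‖ * (‖f i.succ‖ / A) ≤ Q * φ₀ * ℓ i.succ := fun i =>
    (hsrc (hfn i.succ)).trans (mul_le_mul_of_nonneg_right hQ3 (hℓ _))
  have hden : pderivAt (Sum.inl 0) (qoi g fbar f (solutionOp K a)) (fullParam ξ w z) = φ₀ := by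
    rw [pderivAt_inl_qoi, hφ₀]
    rfl
  have hmain := abs_hTerm_le_of_factors hadm t w z (fun j => ‖a j‖) (fun i => ℓ i.succ)
    (fun j => norm_nonneg _) (fun i => hℓ _) hpos hQ1 hden
    fun k => abs_mixedDeriv_qoi_le hunit g fbar f (fullParam ξ w z) hA hW (fun i => hℓ _)
      hsξ hs0 hsi (α k)
  refine hmain.trans (le_of_eq ?_)
  -- `β ≥ 0` excludes `|η| = q = 0`, so that the truncated subtractions are genuine
  have hone : 1 ≤ order η + q := by have := hadm.β_le; omega
  have e1 : 4 * order η + 3 * q - 2 = 2 * (2 * order η + q - 1) + q := by omega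
  have e2 : ℓ 0 * G / A * (|t| + 2 * G / A *
      (Lb + ℓ 0 + 1 + ∑ i : Fin s, ℓ i.succ * |w i|)) = ℓ 0 * γ * X := by
    rw [hX, hL, hγ]
    ring
  rw [e1, e2, hQ, div_pow, ← pow_mul, pow_add]
  field_simp

theorem lemma5p4 {d s : ℕ}
    -- the domain
    (D : Set (EuclideanSpace ℝ (Fin d))) (hDo : IsOpen D) (hDb : Bornology.IsBounded D)
    -- the coefficient and a positive lower bound for it
    (a : Fin s → Lp ℝ ∞ (domMeasure D))
    (amin : (Fin s → ℝ) → ℝ) (hamin_pos : ∀ z, 0 < amin z)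
    (hamin : ∀ z, ∀ᵐ x ∂(domMeasure D), amin z ≤ coeff a z x)
    -- the source; its component `l 0` is given by a bounded function with positive infimum
    (lbar : Hneg1 D) (l : Fin (s + 1) → Hneg1 D)
    (l₀ : Lp ℝ ∞ (domMeasure D))
    (hl₀ : ∀ v : H10 D, l 0 v = ∫ x, l₀ x * H10.val v x ∂(domMeasure D))
    (hl₀_pos : ∃ c > 0, ∀ᵐ x ∂(domMeasure D), c ≤ l₀ x)
    -- the positive linear functional defining the quantity of interest
    (G : Hneg1 D) (hG_pos : IsPositiveFunctional G) (hG_ne : G ≠ 0)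
    -- the solution of the parametric PDE, and the solution for the source `l 0`
    (u : (FullIdx s → ℝ) → H10 D)
    (hu : ∀ y, IsWeakSolution a (fun j => y (Sum.inr j))
      (source lbar l (fun i => y (Sum.inl i))) (u y))
    (u₀ : (Fin s → ℝ) → H10 D) (hu₀ : ∀ z, IsWeakSolution a z (l 0) (u₀ z))
    -- the term to be bounded
    (q : ℕ) (η : RedIdx s → ℕ) (r : ℕ) (α : Fin r → FullIdx s → ℕ) (β : ℕ)
    (hadm : IsAdmissible q η r α β) (t : ℝ) (w z : Fin s → ℝ) :
    |hTerm (fun y => G (u y)) q r α β t w z| ≤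
      1 / √(2 * Real.pi)
        * (((order η).factorial * √((order η + q - 1).factorial : ℝ)) / Real.log 2 ^ order η)
        * (∏ j : Fin s, ‖a j‖ ^ η (Sum.inr j))
        * (∏ i : Fin s, ‖l i.succ‖ ^ η (Sum.inl i))
        * (1 / G (u₀ z) ^ (4 * order η + 3 * q - 2))
        * (‖l 0‖ * ‖G‖ / amin z
            * (|t| + 2 * ‖G‖ / amin z
                * (‖lbar‖ + ‖l 0‖ + 1 + ∑ i : Fin s, ‖l i.succ‖ * |w i|)))
          ^ (2 * order η + q - 1) := by
  have hd : 0 < d := H10.dim_pos_of_ne_zero hG_ne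
  have hcomplete : CompleteSpace (LinearMap.range (H10.grad (D := D))) :=
    (H10.isClosed_range_grad hd hDb).completeSpace_coe
  have hW : ∀ z, ∀ᵐ x ∂(domMeasure D), amin z ≤ weight a [] z x := fun z => by
    filter_upwards [hamin z, coeFn_weight_nil a z] with x h1 h2
    rwa [h2]
  have hunit : ∀ z, IsUnit (compress (LinearMap.range (H10.grad (D := D))) (weight a [] z)) :=
    fun z => isUnit_compress (LinearMap.range (H10.grad (D := D))) (hamin_pos z) (hW z)
  obtain ⟨g, hgn, hg⟩ := H10.exists_riesz hd hDb G
  obtain ⟨fbar, hfbarn, hfbar⟩ := H10.exists_riesz hd hDb lbar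
  choose f hfn hf using fun i => H10.exists_riesz hd hDb (l i)
  have hGu : ∀ v : H10 D, G v = inner ℝ g (⟨H10.grad v, v, rfl⟩ : LinearMap.range (H10.grad (D := D))) := fun v => (hg v).symm
  -- `φ` and `φ₀` in terms of the solution operator
  have hφ : (fun y => G (u y)) = qoi g fbar f (solutionOp (LinearMap.range (H10.grad (D := D))) a) := by
    funext y
    rw [qoi, hGu, H10.grad_eq_solutionOp (hunit _) (hu y) (f := affineSource fbar f y)]
    intro v
    simp [affineSource, source, inner_add_left, sum_inner, real_inner_smul_left, hf, hfbar]
  have hφ₀ : G (u₀ z) = inner ℝ g (solutionOp (LinearMap.range (H10.grad (D := D))) a z (f 0)) := by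
    rw [hGu, H10.grad_eq_solutionOp (hunit _) (hu₀ z) (hf 0)]
  have hpos : 0 < G (u₀ z) := H10.functional_solution_pos hd hDb (hamin_pos z) (hamin z) hl₀
    hl₀_pos hG_pos hG_ne (hu₀ z)
  rw [hφ]
  exact abs_hTerm_qoi_le hunit hgn hfbarn hfn hadm t w z (hamin_pos z) (hW z) hpos hφ₀
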